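/- Let $(E,[\![\cdot,\cdot]\!],\rho)$ be a Lie algebroid over a smooth (finite-dimensional, Hausdorff, boundaryless) manifold $Q$: $\tau:E\to Q$ is a smooth real vector bundle of finite rank, $[\![\cdot,\cdot]\!]$ is a Lie bracket on the space of smooth sections of $E$, and the anchor $\rho:E\to TQ$ is a smooth vector bundle map over $\mathrm{Id}_Q$ such that $[\![\sigma,f\sigma']\!]=f[\![\sigma,\sigma']\!]+(\rho(\sigma)f)\,\sigma'$ for all smooth sections $\sigma,\sigma'$ and all $f\in C^\infty(Q)$. For a Lie algebroid $A$ with anchor $\rho_A$, the differential of a $k$-form $\mu\in\Gamma(\wedge^kA^*)$, $k\ge 0$, is the $(k+1)$-form $$(d^A\mu)(\sigma_0,\dots,\sigma_k)=\sum_{i}(-1)^i\rho_A(\sigma_i)\bigl(\mu(\sigma_0,\dots,\widehat{\sigma_i},\dots,\sigma_k)\bigr)+\sum_{i<j}(-1)^{i+j}\mu([\![\sigma_i,\sigma_j]\!],\sigma_0,\dots,\widehat{\sigma_i},\dots,\widehat{\sigma_j},\dots,\sigma_k);$$ in particular $(d^Af)(a)=\rho_A(a)f$ for a smooth function $f$.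 A smooth vector bundle map $\Phi:A\to B$ over $f:M\to N$ between Lie algebroids $A\to M$ and $B\to N$ is a Lie algebroid morphism if $d^A((\Phi,f)^*\mu)=(\Phi,f)^*(d^B\mu)$ for every smooth $k$-form $\mu$ of $B$ and every $k\ge 0$, where $((\Phi,f)^*\mu)_x(a_1,\dots,a_k)=\mu_{f(x)}(\Phi a_1,\dots,\Phi a_k)$. Let $\pi:E^*\times\mathbb R\to Q$, $(b,s)\mapsto q$ for $b\in E_q^*$, be the projection. The prolongation $\mathcal T^E(E^*\times\mathbb R)$ is the Lie algebroid over $E^*\times\mathbb R$ whose fibre at $p$ is $$\{(a,v)\in E_{\pi(p)}\times T_p(E^*\times\mathbb R)\;:\;\rho(a)=T_p\pi(v)\},$$ whose anchor is $(a,v)\mapsto v$, and whose bracket is given as follows. If $(e_\alpha)$ is a local frame of $E$ and two sections are written as $Z_1=(\sum_\alpha f_\alpha\,e_\alpha\circ\pi,\,X_1)$ and $Z_2=(\sum_\beta g_\beta\,e_\beta\circ\pi,\,X_2)$, with smooth functions $f_\alpha,g_\beta$ and smooth vector fields $X_1,X_2$ on $E^*\times\mathbb R$, then $$[\![Z_1,Z_2]\!]=\Bigl(\sum_{\alpha,\beta}f_\alpha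 g_\beta\,[\![e_\alpha,e_\beta]\!]\circ\pi+\sum_\beta X_1(g_\beta)\,e_\beta\circ\pi-\sum_\alpha X_2(f_\alpha)\,e_\alpha\circ\pi,\;[X_1,X_2]\Bigr).$$ The contact section of $\mathcal T^E(E^*\times\mathbb R)$ is the $1$-form $\eta=\widetilde{\mathcal V}^s-\Theta$, where $\widetilde{\mathcal V}^s_{(b,s)}(a,v)=ds(v)$ and $\Theta_{(b,s)}(a,v)=b(a)$ (the Liouville section). Let $\gamma=(\gamma_0,\gamma_s):Q\to E^*\times\mathbb R$ be any smooth section of $\pi$, with components $\gamma_0\in\Gamma(E^*)$ and $\gamma_s\in C^\infty(Q)$, and let $(\mathrm{Id}_E,T\gamma\circ\rho):E\to\mathcal T^E(E^*\times\mathbb R)$ be the bundle map over $\gamma$ that sends $a\in E_q$ to $(a,\,T_q\gamma(\rho(a)))$. Then: 1. the pair $\bigl((\mathrm{Id}_E,T\gamma\circ\rho),\gamma\bigr)$ is a Lie algebroid morphism from $E$ to $\mathcal T^E(E^*\times\mathbb R)$; 2. $\bigl((\mathrm{Id}_E,T\gamma\circ\rho),\gamma\bigr)^*\eta=d^E\gamma_s-\gamma_0$.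 -/

import Mathlib

open Bundle Set Filter Topology Module VectorField
open scoped Manifold ContDiff

set_option linter.unusedSectionVars false

noncomputable section

/-! ### Preliminaries on vector fields -/

section Calculus

variable {EM : Type*} [NormedAddCommGroup EM] [NormedSpace ℝ EM]
  {HM : Type*} [TopologicalSpace HM] {I : ModelWithCorners ℝ EM HM}
  {M : Type*} [TopologicalSpace M] [ChartedSpace HM M] [IsManifold I ∞ M]

theorem contMDiff_mvfderiv_apply (h : M → ℝ) (hh : ContMDiff I 𝓘(ℝ, ℝ) ∞ h)
    (V : ∀ z : M, TangentSpace I z)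
    (hV : ContMDiff I I.tangent ∞ (fun y => (⟨y, V y⟩ : TangentBundle I M))) :
    ContMDiff I 𝓘(ℝ, ℝ) ∞ (fun y => mvfderiv I h y (V y)) :=
  (contMDiff_snd_tangentBundle_modelSpace ℝ 𝓘(ℝ, ℝ)).comp
    ((hh.contMDiff_tangentMap (m := ∞) le_rfl).comp hV)

theorem mvfderiv_congr {g g' : M → ℝ} {x : M} (hg : g =ᶠ[𝓝 x] g') :
    mvfderiv I g x = mvfderiv I g' x := by
  ext v
  simp only [mvfderiv]
  rw [hg.mfderiv_eq]
  rfl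

theorem mvfderiv_finset_sum {ι : Type*} (s : Finset ι) (g : ι → M → ℝ) (x : M)
    (hg : ∀ i, MDifferentiableAt I 𝓘(ℝ, ℝ) (g i) x) :
    mvfderiv I (fun y => ∑ i ∈ s, g i y) x = ∑ i ∈ s, mvfderiv I (g i) x := by
  classical
  induction s using Finset.induction_on with
  | empty => simpa using mvfderiv_const (I := I) (0 : ℝ) (x := x)
  | insert i s hi ih =>
    have hs : MDifferentiableAt I 𝓘(ℝ, ℝ) (fun y => ∑ i ∈ s, g i y) x := by
      clear ih hi
      induction s using Finset.induction_on with
      | empty => simpa using mdifferentiableAt_const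
      | insert j s hj ih =>
        simp only [Finset.sum_insert hj]
        exact (hg j).add ih
    simp only [Finset.sum_insert hi]
    rw [← ih]
    exact mvfderiv_add (hg i) hs

variable [I.Boundaryless]

/-- A vector field read in the chart at `x`, applied to a function read in that chart. -/
theorem chart_deriv_apply (x : M) (z : EM) (hz : z ∈ (extChartAt I x).target)
    (g : M → ℝ) (hg : MDifferentiableAt I 𝓘(ℝ, ℝ) g ((extChartAt I x).symm z))
    (V : ∀ z : M, TangentSpace I z) :
    fderiv ℝ (g ∘ (extChartAt I x).symm) z
      (mpullbackWithin 𝓘(ℝ, EM) I (extChartAt I x).symm V (range I) z) =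
    mvfderiv I g ((extChartAt I x).symm z) (V ((extChartAt I x).symm z)) := by
  obtain ⟨L, hL⟩ := isInvertible_mfderivWithin_extChartAt_symm (I := I) hz
  have h1 : fderiv ℝ (g ∘ (extChartAt I x).symm) z =
      (mvfderiv I g ((extChartAt I x).symm z)) ∘L
        (mfderivWithin 𝓘(ℝ, EM) I (extChartAt I x).symm (range I) z) := by
    have := mdifferentiableWithinAt_extChartAt_symm (I := I) hz
    rw [I.range_eq_univ, mdifferentiableWithinAt_univ] at this
    rw [I.range_eq_univ, mfderivWithin_univ, ← mvfderiv_comp z hg this]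
    simp only [mvfderiv, mfderiv_eq_fderiv]
    rfl
  rw [h1, mpullbackWithin_apply, ← hL, ContinuousLinearMap.inverse_equiv]
  change mvfderiv I g _ (L (L.symm _)) = _
  rw [L.apply_symm_apply]

theorem mvfderiv_mlieBracket [CompleteSpace EM] (x : M) (h : M → ℝ) (hh : ContMDiff I 𝓘(ℝ, ℝ) ∞ h)
    (V W : ∀ z : M, TangentSpace I z)
    (hV : ContMDiff I I.tangent ∞ (fun y => (⟨y, V y⟩ : TangentBundle I M)))
    (hW : ContMDiff I I.tangent ∞ (fun y => (⟨y, W y⟩ : TangentBundle I M)))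
    (hhV : MDifferentiableAt I 𝓘(ℝ, ℝ) (fun y => mvfderiv I h y (V y)) x)
    (hhW : MDifferentiableAt I 𝓘(ℝ, ℝ) (fun y => mvfderiv I h y (W y)) x) :
    mvfderiv I h x (mlieBracket I V W x) =
      mvfderiv I (fun y => mvfderiv I h y (W y)) x (V x) -
      mvfderiv I (fun y => mvfderiv I h y (V y)) x (W x) := by
  set φ := extChartAt I x with hφ
  have hx : φ x ∈ φ.target := mem_extChartAt_target x
  have hdh : ∀ y, MDifferentiableAt I 𝓘(ℝ, ℝ) h y := fun y => (hh y).mdifferentiableAt (by simp)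
  have hxs : φ.symm (φ x) = x := extChartAt_to_inv x
  have key : ∀ U : (∀ z : M, TangentSpace I z),
      (fun z => fderiv ℝ (h ∘ φ.symm) z (mpullbackWithin 𝓘(ℝ, EM) I φ.symm U (range I) z))
        =ᶠ[𝓝 (φ x)] (fun y => mvfderiv I h y (U y)) ∘ φ.symm := by
    intro U
    filter_upwards [extChartAt_target_mem_nhds (I := I) x] with z hz
    exact chart_deriv_apply x z hz h (hdh _) U
  have hdV : ∀ U : (∀ z : M, TangentSpace I z),
      ContMDiff I I.tangent ∞ (fun y => (⟨y, U y⟩ : TangentBundle I M)) →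
      DifferentiableAt ℝ (mpullbackWithin 𝓘(ℝ, EM) I φ.symm U (range I)) (φ x) := by
    intro U hU
    have := MDifferentiableWithinAt.differentiableWithinAt_mpullbackWithin_vectorField
      (s := univ) (V := U) (x := x)
      (((hU x).mdifferentiableAt (by simp)).mdifferentiableWithinAt)
    rw [preimage_univ, univ_inter] at this
    rw [← hφ] at this
    have h2 : range I = univ := I.range_eq_univ
    exact this.differentiableAt (by rw [h2]; exact univ_mem)
  have hh' : ContDiffAt ℝ ∞ (h ∘ φ.symm) (φ x) := by
    have h1 := contMDiffWithinAt_extChartAt_symm_range (I := I) (n := ∞) x hx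
    rw [I.range_eq_univ, contMDiffWithinAt_univ] at h1
    exact (((hh _).comp (φ x) h1)).contDiffAt
  have e := fderiv_apply_lieBracket (f := h ∘ φ.symm) (n := ∞) hh' (by simpa using (WithTop.coe_le_coe.2 le_top : ((2 : ℕ∞) : ℕ∞ω) ≤ ((⊤ : ℕ∞) : ℕ∞ω))) (hdV W hW) (hdV V hV)
  rw [(key W).fderiv_eq, (key V).fderiv_eq] at e
  rw [chart_deriv_apply x _ hx _ (by rw [hxs]; exact hhW) V,
    chart_deriv_apply x _ hx _ (by rw [hxs]; exact hhV) W] at e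
  have e2 : ∀ U₁ U₂ : (∀ z : M, TangentSpace I z),
      mvfderiv I (fun y => mvfderiv I h y (U₂ y)) (φ.symm (φ x)) (U₁ (φ.symm (φ x))) =
        mvfderiv I (fun y => mvfderiv I h y (U₂ y)) x (U₁ x) := by
    intro U₁ U₂; rw [hxs]
  rw [e2, e2] at e
  rw [← e]
  have hhφ : h =ᶠ[𝓝 x] (h ∘ φ.symm) ∘ φ := by
    filter_upwards [extChartAt_source_mem_nhds (I := I) x] with y hy
    simp only [Function.comp_apply, hφ, (extChartAt I x).left_inv hy]
  have hmφ : MDifferentiableAt I 𝓘(ℝ, EM) φ x :=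
    mdifferentiableAt_extChartAt (mem_chart_source HM x)
  have h3 : mvfderiv I h x = (mvfderiv 𝓘(ℝ, EM) (h ∘ φ.symm) (φ x)) ∘L (mfderiv I 𝓘(ℝ, EM) φ x) := by
    rw [← mvfderiv_comp x (hh'.differentiableAt (by simp)).mdifferentiableAt hmφ]
    exact mvfderiv_congr hhφ
  obtain ⟨L, hL⟩ := isInvertible_mfderiv_extChartAt (I := I) (mem_extChartAt_source (I := I) x)
  rw [← mlieBracketWithin_univ, mlieBracketWithin_apply, h3, ← hφ]
  rw [← hφ] at hL
  have hb : ∀ A B : EM → EM,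
      lieBracketWithin ℝ A B (range I) (φ x) = lieBracket ℝ A B (φ x) := by
    intro A B; rw [I.range_eq_univ, lieBracketWithin_univ]
  rw [← hL, ContinuousLinearMap.inverse_equiv, preimage_univ, univ_inter]
  refine (congrArg (mvfderiv 𝓘(ℝ, EM) (h ∘ φ.symm) (φ x)) (L.apply_symm_apply _)).trans ?_
  refine (congrArg (mvfderiv 𝓘(ℝ, EM) (h ∘ φ.symm) (φ x)) (hb _ _)).trans ?_
  simp only [mvfderiv, mfderiv_eq_fderiv]
  rfl

/-- Smooth functions separate tangent vectors. -/
theorem tangent_ext [FiniteDimensional ℝ EM] [T2Space M] {x : M} (v w : TangentSpace I x)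
    (hvw : ∀ h : M → ℝ, ContMDiff I 𝓘(ℝ, ℝ) ∞ h → mvfderiv I h x v = mvfderiv I h x w) :
    v = w := by
  obtain ⟨L, hL⟩ := isInvertible_mfderiv_extChartAt (I := I) (mem_extChartAt_source (I := I) x)
  apply L.injective
  let b := finBasis ℝ EM
  apply b.ext_elem
  intro i
  let l : EM →L[ℝ] ℝ := LinearMap.toContinuousLinearMap (b.coord i)
  obtain ⟨ψ⟩ : Nonempty (SmoothBumpFunction I x) := inferInstance
  let h : M → ℝ := fun y => ψ y • l (extChartAt I x y)
  have hh : ContMDiff I 𝓘(ℝ, ℝ) ∞ h := by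
    apply ψ.contMDiff_smul
    exact l.contMDiff.comp_contMDiffOn (contMDiffOn_extChartAt)
  have hmφ : MDifferentiableAt I 𝓘(ℝ, EM) (extChartAt I x) x :=
    mdifferentiableAt_extChartAt (mem_chart_source HM x)
  have hev : h =ᶠ[𝓝 x] (l : EM → ℝ) ∘ (extChartAt I x) := by
    filter_upwards [ψ.eventuallyEq_one] with y hy
    simp [h, hy]
  have e : ∀ u : TangentSpace I x, mvfderiv I h x u = l (L u) := by
    intro u
    rw [mvfderiv_congr hev, mvfderiv_comp_apply x l.differentiableAt.mdifferentiableAt hmφ, ← hL]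
    simp only [mvfderiv, mfderiv_eq_fderiv, ContinuousLinearMap.fderiv]
    rfl
  have := hvw h hh
  rw [e, e] at this
  exact this

end Calculus

/-! ### Exterior calculus and morphisms -/

section General

variable {EM : Type*} [NormedAddCommGroup EM] [NormedSpace ℝ EM]
  {HM : Type*} [TopologicalSpace HM] {I : ModelWithCorners ℝ EM HM}
  {M : Type*} [TopologicalSpace M] [ChartedSpace HM M]
  {EN : Type*} [NormedAddCommGroup EN] [NormedSpace ℝ EN]
  {HN : Type*} [TopologicalSpace HN] {J : ModelWithCorners ℝ EN HN}
  {N : Type*} [TopologicalSpace N] [ChartedSpace HN N]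
  {A : M → Type*} [∀ x, AddCommGroup (A x)] [∀ x, Module ℝ (A x)]
  {B : N → Type*} [∀ y, AddCommGroup (B y)] [∀ y, Module ℝ (B y)]

variable (I A) in
/-- What the exterior calculus of a Lie algebroid over `M` with fibres `A x` refers to: the
smooth sections, the anchor and the bracket of sections. It is only used for the two Lie
algebroids `LieAlgebroid.data` and `LieAlgebroid.prolongationData` below. -/
structure BracketData where
  /-- The smooth sections. -/
  Sec : Type*
  /-- The value of a section at a point. -/
  eval : Sec → ∀ x, A x
  /-- The anchor map. -/
  anchor : ∀ x, A x →ₗ[ℝ] TangentSpace I x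
  /-- The bracket of sections. -/
  bracket : Sec → Sec → Sec

namespace BracketData

/-- A field `μ` of alternating `k`-linear forms on the fibres is a smooth `k`-form, i.e. a smooth
section of `⋀ᵏ A*`, if its value on any `k` smooth sections is a smooth function. -/
def IsSmoothForm (D : BracketData I A) {k : ℕ} (μ : ∀ x, A x [⋀^Fin k]→ₗ[ℝ] ℝ) : Prop :=
  ∀ Z : Fin k → D.Sec, ContMDiff I 𝓘(ℝ, ℝ) ∞ (fun x => μ x (fun i => D.eval (Z i) x))

/-- The part `∑_{i < j} (-1)^{i+j} μ([Zᵢ, Zⱼ], Z₀, …, Ẑᵢ, …, Ẑⱼ, …, Z_k)` of the exterior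
differential of a `k`-form `μ`. -/
def bracketTerm (D : BracketData I A) :
    {k : ℕ} → (∀ x, A x [⋀^Fin k]→ₗ[ℝ] ℝ) → (Fin (k + 1) → D.Sec) → M → ℝ
  | 0, _, _, _ => 0
  | k + 1, μ, Z, x =>
    ∑ j : Fin (k + 2), ∑ i : Fin (k + 1),
      if i.castSucc < j then
        (-1 : ℝ) ^ ((i : ℕ) + (j : ℕ)) *
          μ x (Fin.cons (D.eval (D.bracket (Z i.castSucc) (Z j)) x)
            (fun l : Fin k => D.eval (Z (j.succAbove (i.succAbove l))) x))
      else 0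

/-- The exterior differential of a `k`-form `μ`, evaluated on `k + 1` sections:
`(dμ)(Z₀, …, Z_k) = ∑ᵢ (-1)^i ρ(Zᵢ) μ(Z₀, …, Ẑᵢ, …, Z_k)
  + ∑_{i < j} (-1)^{i+j} μ([Zᵢ, Zⱼ], Z₀, …, Ẑᵢ, …, Ẑⱼ, …, Z_k)`. -/
def extDeriv (D : BracketData I A) {k : ℕ} (μ : ∀ x, A x [⋀^Fin k]→ₗ[ℝ] ℝ)
    (Z : Fin (k + 1) → D.Sec) (x : M) : ℝ :=
  (∑ i : Fin (k + 1), (-1 : ℝ) ^ (i : ℕ) *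
    mvfderiv I (fun y => μ y (fun l : Fin k => D.eval (Z (i.succAbove l)) y)) x
      (D.anchor x (D.eval (Z i) x))) +
  D.bracketTerm μ Z x

end BracketData

/-- The pullback `(Φ, f)*μ`, with `((Φ, f)*μ)_x(a₁, …, a_k) = μ_{f(x)}(Φ a₁, …, Φ a_k)`. -/
def pullbackForm {k : ℕ} (f : M → N) (Φ : ∀ x, A x →ₗ[ℝ] B (f x))
    (μ : ∀ y, B y [⋀^Fin k]→ₗ[ℝ] ℝ) : ∀ x, A x [⋀^Fin k]→ₗ[ℝ] ℝ :=
  fun x => (μ (f x)).compLinearMap (Φ x)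

/-- A fibrewise linear map `Φ` over `f` is a morphism of Lie algebroids if it is smooth and
`d((Φ, f)*μ) = (Φ, f)*(dμ)` for all smooth `k`-forms `μ` and all `k`. Smoothness of the bundle map
is expressed by the smoothness of the pullbacks of smooth forms. The equality of `(k + 1)`-forms
is tested at each point `x` on the values of sections `σᵢ`; there the value of `dμ` at `f x` on
the vectors `Φ(σᵢ(x))` is computed with any sections `Zᵢ` that take these values at `f x`. -/
structure IsLieAlgebroidMorphism (D : BracketData I A) (D' : BracketData J B) (f : M → N)
    (Φ : ∀ x, A x →ₗ[ℝ] B (f x)) : Prop where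
  contMDiff_base : ContMDiff I J ∞ f
  smooth_pullback : ∀ {k : ℕ} (μ : ∀ y, B y [⋀^Fin k]→ₗ[ℝ] ℝ), D'.IsSmoothForm μ →
    D.IsSmoothForm (pullbackForm f Φ μ)
  extDeriv_pullback : ∀ {k : ℕ} (μ : ∀ y, B y [⋀^Fin k]→ₗ[ℝ] ℝ), D'.IsSmoothForm μ →
    ∀ (x : M) (σ : Fin (k + 1) → D.Sec) (Z : Fin (k + 1) → D'.Sec),
      (∀ i, D'.eval (Z i) (f x) = Φ x (D.eval (σ i) x)) →
        D.extDeriv (pullbackForm f Φ μ) σ x = D'.extDeriv μ Z (f x)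

end General

/-! ### Lie algebroids -/

section Algebroid

variable {EQ : Type*} [NormedAddCommGroup EQ] [NormedSpace ℝ EQ]
  {HQ : Type*} [TopologicalSpace HQ] (I : ModelWithCorners ℝ EQ HQ)
  {Q : Type*} [TopologicalSpace Q] [ChartedSpace HQ Q]
  (F : Type*) [NormedAddCommGroup F] [NormedSpace ℝ F]
  (E : Q → Type*) [∀ q, AddCommGroup (E q)] [∀ q, Module ℝ (E q)]
  [TopologicalSpace (TotalSpace F E)] [∀ q, TopologicalSpace (E q)]
  [FiberBundle F E] [VectorBundle ℝ F E]

variable {I F E} in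
/-- The product of a smooth function and a smooth section. -/
def smulSection (f : C^∞⟮I, Q; ℝ⟯) (σ : Cₛ^∞⟮I; F, E⟯) : Cₛ^∞⟮I; F, E⟯ :=
  ⟨fun q => f q • σ q, f.contMDiff.smul_section σ.contMDiff⟩

/-- A Lie algebroid structure on the smooth vector bundle `E → Q`: a Lie bracket on the smooth
sections and a smooth vector bundle map `ρ : E → TQ` with
`[σ, f τ] = f [σ, τ] + (ρ(σ) f) τ`. -/
structure LieAlgebroid [IsManifold I ∞ Q] where
  bracket : Cₛ^∞⟮I; F, E⟯ → Cₛ^∞⟮I; F, E⟯ → Cₛ^∞⟮I; F, E⟯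
  bracket_add_left : ∀ σ₁ σ₂ τ, bracket (σ₁ + σ₂) τ = bracket σ₁ τ + bracket σ₂ τ
  bracket_smul_left : ∀ (c : ℝ) (σ τ), bracket (c • σ) τ = c • bracket σ τ
  bracket_skew : ∀ σ τ, bracket σ τ = -bracket τ σ
  jacobi : ∀ σ τ υ,
    bracket σ (bracket τ υ) + bracket τ (bracket υ σ) + bracket υ (bracket σ τ) = 0
  anchor : ∀ q, E q →ₗ[ℝ] TangentSpace I q
  contMDiff_anchor : ContMDiff (I.prod 𝓘(ℝ, F)) I.tangent ∞
    (fun a : TotalSpace F E => (⟨a.proj, anchor a.proj a.2⟩ : TangentBundle I Q))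
  leibniz : ∀ (σ τ : Cₛ^∞⟮I; F, E⟯) (f : C^∞⟮I, Q; ℝ⟯) (q : Q),
    bracket σ (smulSection f τ) q =
      f q • bracket σ τ q + mvfderiv I f q (anchor q (σ q)) • τ q

section Frame

variable [FiniteDimensional ℝ EQ] [T2Space Q] [IsManifold I ∞ Q]
  [FiniteDimensional ℝ F] [ContMDiffVectorBundle ∞ F E I]

theorem exists_bump (q₀ : Q) :
    ∃ ψ : SmoothBumpFunction I q₀, tsupport ψ ⊆ (trivializationAt F E q₀).baseSet := by
  obtain ⟨ψ, -, h⟩ := (SmoothBumpFunction.nhds_basis_tsupport (I := I) q₀).mem_iff.1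
    ((trivializationAt F E q₀).open_baseSet.mem_nhds (mem_baseSet_trivializationAt F E q₀))
  exact ⟨ψ, h⟩

/-- A smooth bump function at `q₀` supported in the domain of a trivialization of `E`. -/
def bump (q₀ : Q) : SmoothBumpFunction I q₀ := (exists_bump I F E q₀).choose

theorem tsupport_bump (q₀ : Q) :
    tsupport (bump I F E q₀) ⊆ (trivializationAt F E q₀).baseSet :=
  (exists_bump I F E q₀).choose_spec

/-- Global smooth sections of `E` that form a local frame near `q₀`. -/
def frame (q₀ : Q) (i : Fin (finrank ℝ F)) : Cₛ^∞⟮I; F, E⟯ :=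
  ⟨fun q => bump I F E q₀ q • (trivializationAt F E q₀).localFrame (finBasis ℝ F) i q,
    ContMDiffOn.smul_section_of_tsupport (u := (trivializationAt F E q₀).baseSet)
      (bump I F E q₀).contMDiff.contMDiffOn
      (trivializationAt F E q₀).open_baseSet (tsupport_bump I F E q₀)
      ((trivializationAt F E q₀).contMDiffOn_localFrame_baseSet ∞ (finBasis ℝ F) i)⟩

/-- The smooth functions on the total space of `E`, linear on the fibres, whose restriction to
the fibres near `q₀` is the dual basis of `frame I F E q₀`. -/
def coframe (q₀ : Q) (i : Fin (finrank ℝ F)) (a : TotalSpace F E) : ℝ :=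
  bump I F E q₀ a.proj * (finBasis ℝ F).repr (trivializationAt F E q₀ a).2 i

theorem contMDiff_coframe (q₀ : Q) (i : Fin (finrank ℝ F)) :
    ContMDiff (I.prod 𝓘(ℝ, F)) 𝓘(ℝ, ℝ) ∞ (coframe I F E q₀ i) := by
  have hc : Continuous (TotalSpace.proj : TotalSpace F E → Q) := (contMDiff_proj E (n := ∞)
    (IB := I)).continuous
  apply contMDiff_of_contMDiffOn_union_of_isOpen
    (s := (TotalSpace.proj : TotalSpace F E → Q) ⁻¹' (trivializationAt F E q₀).baseSet)
    (t := (TotalSpace.proj : TotalSpace F E → Q) ⁻¹' (tsupport (bump I F E q₀))ᶜ)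
  · apply ContMDiffOn.mul
    · exact ((bump I F E q₀).contMDiff.comp (contMDiff_proj E)).contMDiffOn
    · have h1 := (trivializationAt F E q₀).contMDiffOn (IB := I) (n := ∞)
      rw [(trivializationAt F E q₀).source_eq] at h1
      have h2 : ContMDiff 𝓘(ℝ, F) 𝓘(ℝ, ℝ) ∞ (fun v => (finBasis ℝ F).coord i v) :=
        (LinearMap.toContinuousLinearMap ((finBasis ℝ F).coord i)).contMDiff
      exact h2.comp_contMDiffOn (contMDiff_snd.comp_contMDiffOn h1)
  · apply (contMDiffOn_const (c := (0 : ℝ))).congr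
    intro a ha
    simp only [coframe]
    rw [image_eq_zero_of_notMem_tsupport ha, zero_mul]
  · rw [← preimage_union, eq_univ_iff_forall]
    intro a
    by_cases h : a.proj ∈ tsupport (bump I F E q₀)
    · exact Or.inl (tsupport_bump I F E q₀ h)
    · exact Or.inr h
  · exact (trivializationAt F E q₀).open_baseSet.preimage hc
  · exact (isClosed_tsupport _).isOpen_compl.preimage hc

variable {I F E} in
theorem sum_coframe_smul_frame (q₀ q : Q) (hq : bump I F E q₀ q = 1) (a : E q) :
    ∑ i, coframe I F E q₀ i ⟨q, a⟩ • frame I F E q₀ i q = a := by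
  have hq' : q ∈ (trivializationAt F E q₀).baseSet := by
    apply tsupport_bump I F E q₀ (subset_tsupport _ _)
    rw [Function.mem_support, hq]; exact one_ne_zero
  have h : ∀ i, coframe I F E q₀ i ⟨q, a⟩ • frame I F E q₀ i q =
      ((trivializationAt F E q₀).basisAt (finBasis ℝ F) hq').repr a i •
        (trivializationAt F E q₀).basisAt (finBasis ℝ F) hq' i := by
    intro i
    have : frame I F E q₀ i q = bump I F E q₀ q •
      (trivializationAt F E q₀).localFrame (finBasis ℝ F) i q := rfl
    rw [this, (trivializationAt F E q₀).localFrame_apply_of_mem_baseSet (finBasis ℝ F) hq', coframe]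
    simp only [hq, one_smul, one_mul]
    congr 1
  rw [Finset.sum_congr rfl (fun i _ => h i), Basis.sum_repr]

variable {I F E} in
theorem coframe_sum (q₀ q : Q) (i : Fin (finrank ℝ F)) {ι : Type*} (t : Finset ι) (a : ι → E q) :
    coframe I F E q₀ i ⟨q, ∑ k ∈ t, a k⟩ = ∑ k ∈ t, coframe I F E q₀ i ⟨q, a k⟩ := by
  by_cases hq : q ∈ (trivializationAt F E q₀).baseSet
  · have h : ∀ a : E q, coframe I F E q₀ i ⟨q, a⟩ = bump I F E q₀ q * (finBasis ℝ F).coord i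
        ((trivializationAt F E q₀).linearEquivAt ℝ q hq a) := fun _ => rfl
    simp only [h, map_sum, Finset.mul_sum]
  · have h : ∀ a : E q, coframe I F E q₀ i ⟨q, a⟩ = 0 := by
      intro a
      simp only [coframe]
      rw [image_eq_zero_of_notMem_tsupport (fun h => hq (tsupport_bump I F E q₀ h)), zero_mul]
    simp [h]

variable {I F E} in
theorem coframe_smul (q₀ q : Q) (i : Fin (finrank ℝ F)) (c : ℝ) (a : E q)
    (hq : bump I F E q₀ q = 1) :
    coframe I F E q₀ i ⟨q, c • a⟩ = c * coframe I F E q₀ i ⟨q, a⟩ := by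
  have hq' : q ∈ (trivializationAt F E q₀).baseSet := by
    apply tsupport_bump I F E q₀ (subset_tsupport _ _)
    rw [Function.mem_support, hq]; exact one_ne_zero
  have h : ∀ a : E q, coframe I F E q₀ i ⟨q, a⟩ = bump I F E q₀ q * (finBasis ℝ F).coord i
      ((trivializationAt F E q₀).linearEquivAt ℝ q hq' a) := fun _ => rfl
  simp only [h, map_smul, smul_eq_mul]
  ring

end Frame
namespace LieAlgebroid

variable {I F E} [IsManifold I ∞ Q] (𝓔 : LieAlgebroid I F E)

/-- The vector field `ρ(σ)` is smooth. -/
theorem contMDiff_anchor_section (σ : Cₛ^∞⟮I; F, E⟯) :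
    ContMDiff I I.tangent ∞ (fun q => (⟨q, 𝓔.anchor q (σ q)⟩ : TangentBundle I Q)) :=
  𝓔.contMDiff_anchor.comp σ.contMDiff

/-- The function `ρ(σ) f`. -/
def anchorDeriv (σ : Cₛ^∞⟮I; F, E⟯) (f : C^∞⟮I, Q; ℝ⟯) : C^∞⟮I, Q; ℝ⟯ :=
  ⟨fun q => mvfderiv I f q (𝓔.anchor q (σ q)),
    contMDiff_mvfderiv_apply f f.contMDiff _ (𝓔.contMDiff_anchor_section σ)⟩

theorem leibniz' (σ τ : Cₛ^∞⟮I; F, E⟯) (f : C^∞⟮I, Q; ℝ⟯) :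
    𝓔.bracket σ (smulSection f τ) =
      smulSection f (𝓔.bracket σ τ) + smulSection (𝓔.anchorDeriv σ f) τ := by
  ext q
  exact 𝓔.leibniz σ τ f q

theorem bracket_add_right (σ τ υ : Cₛ^∞⟮I; F, E⟯) :
    𝓔.bracket σ (τ + υ) = 𝓔.bracket σ τ + 𝓔.bracket σ υ := by
  rw [𝓔.bracket_skew, 𝓔.bracket_add_left, 𝓔.bracket_skew τ, 𝓔.bracket_skew υ]
  abel

theorem bracket_smul_right (c : ℝ) (σ τ : Cₛ^∞⟮I; F, E⟯) :
    𝓔.bracket σ (c • τ) = c • 𝓔.bracket σ τ := by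
  rw [𝓔.bracket_skew, 𝓔.bracket_smul_left, 𝓔.bracket_skew τ, smul_neg, neg_neg]

theorem bracket_bracket (σ τ υ : Cₛ^∞⟮I; F, E⟯) :
    𝓔.bracket (𝓔.bracket σ τ) υ =
      𝓔.bracket σ (𝓔.bracket τ υ) - 𝓔.bracket τ (𝓔.bracket σ υ) := by
  have h := 𝓔.jacobi σ τ υ
  rw [𝓔.bracket_skew υ σ, 𝓔.bracket_skew υ (𝓔.bracket σ τ)] at h
  have h2 : 𝓔.bracket τ (-𝓔.bracket σ υ) = -𝓔.bracket τ (𝓔.bracket σ υ) := by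
    have := 𝓔.bracket_smul_right (-1) τ (𝓔.bracket σ υ)
    simpa using this
  rw [h2] at h
  rw [← sub_eq_zero, ← neg_eq_zero, ← h]
  abel

/-- The anchor is a homomorphism of Lie algebras: `ρ[σ, τ] f = ρ(σ)ρ(τ) f - ρ(τ)ρ(σ) f`. -/
theorem anchorDeriv_bracket (σ τ : Cₛ^∞⟮I; F, E⟯) (f : C^∞⟮I, Q; ℝ⟯) (q : Q) :
    𝓔.anchorDeriv (𝓔.bracket σ τ) f q =
      𝓔.anchorDeriv σ (𝓔.anchorDeriv τ f) q - 𝓔.anchorDeriv τ (𝓔.anchorDeriv σ f) q := by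
  by_cases hυ : ∃ υ : Cₛ^∞⟮I; F, E⟯, υ q ≠ 0
  · obtain ⟨υ, hυ⟩ := hυ
    have h := 𝓔.bracket_bracket σ τ (smulSection f υ)
    rw [𝓔.leibniz', 𝓔.leibniz', 𝓔.leibniz' σ, 𝓔.bracket_add_right, 𝓔.bracket_add_right,
      𝓔.leibniz', 𝓔.leibniz', 𝓔.leibniz', 𝓔.leibniz', 𝓔.bracket_bracket] at h
    have h2 := congrArg (fun s : Cₛ^∞⟮I; F, E⟯ => s q) h
    simp only [smulSection, ContMDiffSection.coe_add, ContMDiffSection.coe_sub, Pi.add_apply,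
      Pi.sub_apply, ContMDiffSection.coeFn_mk] at h2
    have h3 : (𝓔.anchorDeriv (𝓔.bracket σ τ) f q - (𝓔.anchorDeriv σ (𝓔.anchorDeriv τ f) q -
        𝓔.anchorDeriv τ (𝓔.anchorDeriv σ f) q)) • υ q = 0 := by
      rw [← sub_eq_zero] at h2
      rw [← h2]
      module
    exact sub_eq_zero.1 ((smul_eq_zero.1 h3).resolve_right hυ)
  · push Not at hυ
    have h0 : ∀ (σ : Cₛ^∞⟮I; F, E⟯) (f : C^∞⟮I, Q; ℝ⟯), 𝓔.anchorDeriv σ f q = 0 := by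
      intro σ f
      change mvfderiv I f q (𝓔.anchor q (σ q)) = 0
      rw [hυ, map_zero, map_zero]
    simp [h0]

section Locality

variable [FiniteDimensional ℝ EQ] [T2Space Q]

/-- The bracket is local. -/
theorem bracket_congr_right (τ s s' : Cₛ^∞⟮I; F, E⟯) (q : Q) (h : ∀ᶠ q' in 𝓝 q, s q' = s' q') :
    𝓔.bracket τ s q = 𝓔.bracket τ s' q := by
  obtain ⟨ψ, -, hψ⟩ := (SmoothBumpFunction.nhds_basis_tsupport (I := I) q).mem_iff.1 h
  let f : C^∞⟮I, Q; ℝ⟯ := ⟨ψ, ψ.contMDiff⟩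
  have e : smulSection f s = smulSection f s' := by
    ext q'
    change ψ q' • s q' = ψ q' • s' q'
    by_cases hq : q' ∈ tsupport ψ
    · rw [show s q' = s' q' from hψ hq]
    · rw [image_eq_zero_of_notMem_tsupport hq, zero_smul, zero_smul]
  have h1 := 𝓔.leibniz τ s f q
  have h2 := 𝓔.leibniz τ s' f q
  have hf : f q = 1 := ψ.eq_one
  rw [hf, one_smul] at h1 h2
  rw [e, h2, h.self_of_nhds] at h1
  exact (add_right_cancel h1).symm

theorem sum_section_apply {ι : Type*} (t : Finset ι) (s : ι → Cₛ^∞⟮I; F, E⟯) (q : Q) :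
    (∑ i ∈ t, s i) q = ∑ i ∈ t, s i q := by
  classical
  induction t using Finset.induction_on with
  | empty => rfl
  | insert i t hi ih =>
    rw [Finset.sum_insert hi, Finset.sum_insert hi, ContMDiffSection.coe_add, Pi.add_apply, ih]

theorem bracket_sum_right {ι : Type*} (t : Finset ι) (τ : Cₛ^∞⟮I; F, E⟯)
    (s : ι → Cₛ^∞⟮I; F, E⟯) :
    𝓔.bracket τ (∑ i ∈ t, s i) = ∑ i ∈ t, 𝓔.bracket τ (s i) := by
  classical
  induction t using Finset.induction_on with
  | empty =>
    have := 𝓔.bracket_smul_right 0 τ 0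
    simpa using this
  | insert i t hi ih =>
    rw [Finset.sum_insert hi, Finset.sum_insert hi, 𝓔.bracket_add_right, ih]

end Locality

variable {EP : Type*} [NormedAddCommGroup EP] [NormedSpace ℝ EP]
  {HP : Type*} [TopologicalSpace HP] (IP : ModelWithCorners ℝ EP HP)
  {P : Type*} [TopologicalSpace P] [ChartedSpace HP P] [IsManifold IP ∞ P]

/-- The fibre of the prolongation over `pr : P → Q` at `p`: the pairs `(a, v)` with
`a ∈ E_{pr(p)}`, `v ∈ T_p P` and `ρ(a) = Tpr(v)`. -/
def prolongation (pr : P → Q) (p : P) : Submodule ℝ (E (pr p) × TangentSpace IP p) where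
  carrier := {x | 𝓔.anchor (pr p) x.1 = mfderiv IP I pr p x.2}
  add_mem' {x y} hx hy := by
    change 𝓔.anchor (pr p) (x + y).1 = mfderiv IP I pr p (x + y).2
    rw [Prod.fst_add, Prod.snd_add, map_add, map_add, hx, hy]
  zero_mem' := by simp
  smul_mem' c x hx := by
    change 𝓔.anchor (pr p) (c • x).1 = mfderiv IP I pr p (c • x).2
    rw [Prod.smul_fst, Prod.smul_snd, map_smul, map_smul, hx]

/-- Smooth sections of the prolongation, as pairs of a smooth section of `E` along `pr` and
a smooth vector field on `P`. -/
structure ProlongationSection (pr : P → Q) where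
  fst : ∀ p : P, E (pr p)
  vec : ∀ p : P, TangentSpace IP p
  contMDiff_fst : ContMDiff IP (I.prod 𝓘(ℝ, F)) ∞ (fun p => (⟨pr p, fst p⟩ : TotalSpace F E))
  contMDiff_vec : ContMDiff IP IP.tangent ∞ (fun p => (⟨p, vec p⟩ : TangentBundle IP P))
  anchor_fst : ∀ p, 𝓔.anchor (pr p) (fst p) = mfderiv IP I pr p (vec p)

namespace ProlongationSection

variable {𝓔 IP} {pr : P → Q}

/-- The section as a map into the fibres of the prolongation. -/
def eval (Z : 𝓔.ProlongationSection IP pr) (p : P) : 𝓔.prolongation IP pr p :=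
  ⟨(Z.fst p, Z.vec p), Z.anchor_fst p⟩

variable [FiniteDimensional ℝ EQ] [T2Space Q] [FiniteDimensional ℝ F] [ContMDiffVectorBundle ∞ F E I]

/-- The coefficients of the `E`-component of a section in the frame of `E` near `q₀`. -/
def coeff (Z : 𝓔.ProlongationSection IP pr) (q₀ : Q) (i : Fin (finrank ℝ F)) (p : P) : ℝ :=
  coframe I F E q₀ i ⟨pr p, Z.fst p⟩

theorem contMDiff_coeff (Z : 𝓔.ProlongationSection IP pr) (q₀ : Q) (i : Fin (finrank ℝ F)) :
    ContMDiff IP 𝓘(ℝ, ℝ) ∞ (Z.coeff q₀ i) :=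
  (contMDiff_coframe I F E q₀ i).comp Z.contMDiff_fst

/-- If `Z₁ = (Σᵢ fᵢ eᵢ, X₁)` and `Z₂ = (Σⱼ gⱼ eⱼ, X₂)` in the frame `e` near `q₀`, this is
`Σᵢⱼ fᵢ gⱼ [eᵢ, eⱼ] + Σⱼ X₁(gⱼ) eⱼ - Σᵢ X₂(fᵢ) eᵢ`. -/
def bracketFst (Z₁ Z₂ : 𝓔.ProlongationSection IP pr) (q₀ : Q) (p : P) : E (pr p) :=
  (∑ i, ∑ j, (Z₁.coeff q₀ i p * Z₂.coeff q₀ j p) •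
      𝓔.bracket (frame I F E q₀ i) (frame I F E q₀ j) (pr p)) +
    (∑ j, mvfderiv IP (Z₂.coeff q₀ j) p (Z₁.vec p) • frame I F E q₀ j (pr p)) -
    ∑ i, mvfderiv IP (Z₁.coeff q₀ i) p (Z₂.vec p) • frame I F E q₀ i (pr p)

theorem mvfderiv_comp_proj (hpr : ContMDiff IP I ∞ pr) (Z : 𝓔.ProlongationSection IP pr) (q₀ : Q)
    (f : C^∞⟮I, Q; ℝ⟯) (p : P) (hp : bump I F E q₀ (pr p) = 1) :
    mvfderiv IP (f ∘ pr) p (Z.vec p) =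
      ∑ i, Z.coeff q₀ i p * 𝓔.anchorDeriv (frame I F E q₀ i) f (pr p) := by
  rw [mvfderiv_comp_apply p ((f.contMDiff _).mdifferentiableAt (by simp))
    ((hpr p).mdifferentiableAt (by simp)), ← Z.anchor_fst]
  conv_lhs => rw [← sum_coframe_smul_frame q₀ (pr p) hp (Z.fst p)]
  simp only [map_sum, map_smul, smul_eq_mul]
  rfl

theorem anchor_bracketFst [I.Boundaryless] [FiniteDimensional ℝ EP] [IP.Boundaryless]
    (hpr : ContMDiff IP I ∞ pr) (Z₁ Z₂ : 𝓔.ProlongationSection IP pr)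
    (q₀ : Q) (p : P) (hp : ∀ᶠ q in 𝓝 (pr p), bump I F E q₀ q = 1) :
    𝓔.anchor (pr p) (bracketFst Z₁ Z₂ q₀ p) =
      mfderiv IP I pr p (mlieBracket IP Z₁.vec Z₂.vec p) := by
  have := FiniteDimensional.complete ℝ EP
  apply tangent_ext
  intro h hh
  let f : C^∞⟮I, Q; ℝ⟯ := ⟨h, hh⟩
  have hd : ∀ {g : P → ℝ}, ContMDiff IP 𝓘(ℝ, ℝ) ∞ g → ∀ p, MDifferentiableAt IP 𝓘(ℝ, ℝ) g p :=
    fun hg p => (hg p).mdifferentiableAt (by simp)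
  have hfpr : ContMDiff IP 𝓘(ℝ, ℝ) ∞ (f ∘ pr) := f.contMDiff.comp hpr
  have hnear : ∀ᶠ p' in 𝓝 p, bump I F E q₀ (pr p') = 1 :=
    hpr.continuous.continuousAt.eventually hp
  have hder : ∀ Z Z' : 𝓔.ProlongationSection IP pr,
      mvfderiv IP (fun y => mvfderiv IP (f ∘ pr) y (Z'.vec y)) p (Z.vec p) =
        ∑ j, (mvfderiv IP (Z'.coeff q₀ j) p (Z.vec p) *
              𝓔.anchorDeriv (frame I F E q₀ j) f (pr p) +
            Z'.coeff q₀ j p * ∑ i, Z.coeff q₀ i p *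
              𝓔.anchorDeriv (frame I F E q₀ i) (𝓔.anchorDeriv (frame I F E q₀ j) f) (pr p)) := by
    intro Z Z'
    have hev : (fun y => mvfderiv IP (f ∘ pr) y (Z'.vec y)) =ᶠ[𝓝 p]
        fun y => ∑ j, Z'.coeff q₀ j y * (𝓔.anchorDeriv (frame I F E q₀ j) f ∘ pr) y := by
      filter_upwards [hnear] with y hy
      exact mvfderiv_comp_proj hpr Z' q₀ f y hy
    rw [mvfderiv_congr hev, mvfderiv_finset_sum, _root_.sum_apply]
    · refine Finset.sum_congr rfl fun j _ => ?_
      have hF : ContMDiff IP 𝓘(ℝ, ℝ) ∞ (𝓔.anchorDeriv (frame I F E q₀ j) f ∘ pr) :=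
        (𝓔.anchorDeriv (frame I F E q₀ j) f).contMDiff.comp hpr
      have hm := mvfderiv_mul (hd (Z'.contMDiff_coeff q₀ j) p) (hd hF p)
      have hm' := congrArg (fun T => T (Z.vec p)) hm
      have hp0 := mvfderiv_comp_proj hpr Z q₀ (𝓔.anchorDeriv (frame I F E q₀ j) f) p hp.self_of_nhds
      rw [← hp0]
      refine hm'.trans ?_
      simp only [_root_.add_apply, _root_.smul_apply, smul_eq_mul,
        Function.comp_apply]
      ring
    · exact fun j => hd ((Z'.contMDiff_coeff q₀ j).mul
        ((𝓔.anchorDeriv (frame I F E q₀ j) f).contMDiff.comp hpr)) p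
  have hcomm := mvfderiv_mlieBracket p (f ∘ pr) hfpr Z₁.vec Z₂.vec Z₁.contMDiff_vec
    Z₂.contMDiff_vec (hd (contMDiff_mvfderiv_apply _ hfpr _ Z₁.contMDiff_vec) p)
    (hd (contMDiff_mvfderiv_apply _ hfpr _ Z₂.contMDiff_vec) p)
  rw [hder, hder, mvfderiv_comp_apply p ((f.contMDiff _).mdifferentiableAt (by simp))
    ((hpr p).mdifferentiableAt (by simp))] at hcomm
  refine Eq.trans ?_ hcomm.symm
  have hb : ∀ σ : Cₛ^∞⟮I; F, E⟯,
      mvfderiv I h (pr p) (𝓔.anchor (pr p) (σ (pr p))) = 𝓔.anchorDeriv σ f (pr p) := fun _ => rfl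
  simp only [bracketFst, map_add, map_sub, map_sum, map_smul, smul_eq_mul, hb,
    𝓔.anchorDeriv_bracket, mul_sub, Finset.sum_sub_distrib, Finset.sum_add_distrib, Finset.mul_sum]
  have hs : ∀ (a b : Fin (finrank ℝ F) → ℝ) (c : Fin (finrank ℝ F) → Fin (finrank ℝ F) → ℝ),
      ∑ i, ∑ j, a i * b j * c i j = ∑ j, ∑ i, b j * (a i * c i j) := by
    intro a b c
    rw [Finset.sum_comm]
    exact Finset.sum_congr rfl fun j _ => Finset.sum_congr rfl fun i _ => by ring
  have hs' : ∀ (a b : Fin (finrank ℝ F) → ℝ) (c : Fin (finrank ℝ F) → Fin (finrank ℝ F) → ℝ),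
      ∑ i, ∑ j, a i * b j * c j i = ∑ i, ∑ j, a i * (b j * c j i) := by
    intro a b c
    exact Finset.sum_congr rfl fun j _ => Finset.sum_congr rfl fun i _ => by ring
  rw [hs (fun i => Z₁.coeff q₀ i p) (fun i => Z₂.coeff q₀ i p)
      (fun i j => 𝓔.anchorDeriv (frame I F E q₀ i) (𝓔.anchorDeriv (frame I F E q₀ j) f) (pr p)),
    hs' (fun i => Z₁.coeff q₀ i p) (fun i => Z₂.coeff q₀ i p)
      (fun i j => 𝓔.anchorDeriv (frame I F E q₀ i) (𝓔.anchorDeriv (frame I F E q₀ j) f) (pr p))]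
  ring

theorem fst_eq (Z : 𝓔.ProlongationSection IP pr) (q₀ : Q) (p : P)
    (hp : bump I F E q₀ (pr p) = 1) :
    Z.fst p = ∑ i, Z.coeff q₀ i p • frame I F E q₀ i (pr p) :=
  (sum_coframe_smul_frame q₀ (pr p) hp (Z.fst p)).symm

/-- The transition functions between two frames. -/
def transition (q₀ q₁ : Q) (a i : Fin (finrank ℝ F)) : C^∞⟮I, Q; ℝ⟯ :=
  ⟨fun q => coframe I F E q₀ i ⟨q, frame I F E q₁ a q⟩,
    (contMDiff_coframe I F E q₀ i).comp (frame I F E q₁ a).contMDiff⟩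

theorem coeff_eq_sum (Z : 𝓔.ProlongationSection IP pr) (q₀ q₁ : Q) (i : Fin (finrank ℝ F)) (p : P)
    (h₀ : bump I F E q₀ (pr p) = 1) (h₁ : bump I F E q₁ (pr p) = 1) :
    Z.coeff q₀ i p = ∑ a, Z.coeff q₁ a p * transition (I := I) (F := F) (E := E) q₀ q₁ a i (pr p) := by
  have e : Z.coeff q₀ i p = coframe I F E q₀ i ⟨pr p, Z.fst p⟩ := rfl
  rw [e, Z.fst_eq q₁ p h₁, coframe_sum]
  exact Finset.sum_congr rfl fun a _ => coframe_smul _ _ _ _ _ h₀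

/-- One half of the formula for the bracket does not depend on the frame. -/
theorem half_bracket_eq (hpr : ContMDiff IP I ∞ pr) (Z : 𝓔.ProlongationSection IP pr) (q₀ q₁ : Q) (p : P)
    (h₀ : ∀ᶠ q in 𝓝 (pr p), bump I F E q₀ q = 1) (h₁ : ∀ᶠ q in 𝓝 (pr p), bump I F E q₁ q = 1)
    (τ : Cₛ^∞⟮I; F, E⟯) (X : TangentSpace IP p)
    (hX : 𝓔.anchor (pr p) (τ (pr p)) = mfderiv IP I pr p X) :
    (∑ i, Z.coeff q₁ i p • 𝓔.bracket (frame I F E q₁ i) τ (pr p)) -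
      ∑ i, mvfderiv IP (Z.coeff q₁ i) p X • frame I F E q₁ i (pr p) =
    (∑ i, Z.coeff q₀ i p • 𝓔.bracket (frame I F E q₀ i) τ (pr p)) -
      ∑ i, mvfderiv IP (Z.coeff q₀ i) p X • frame I F E q₀ i (pr p) := by
  let A : Fin (finrank ℝ F) → Fin (finrank ℝ F) → C^∞⟮I, Q; ℝ⟯ := transition (E := E) q₀ q₁
  have hd : ∀ {g : P → ℝ}, ContMDiff IP 𝓘(ℝ, ℝ) ∞ g → MDifferentiableAt IP 𝓘(ℝ, ℝ) g p :=
    fun hg => (hg p).mdifferentiableAt (by simp)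
  have hA : ∀ a, ∀ᶠ q in 𝓝 (pr p), frame I F E q₁ a q = ∑ i, A a i q • frame I F E q₀ i q := by
    intro a
    filter_upwards [h₀] with q hq
    exact (sum_coframe_smul_frame q₀ q hq _).symm
  have hbr : ∀ a, 𝓔.bracket (frame I F E q₁ a) τ (pr p) =
      ∑ i, (A a i (pr p) • 𝓔.bracket (frame I F E q₀ i) τ (pr p) -
        𝓔.anchorDeriv τ (A a i) (pr p) • frame I F E q₀ i (pr p)) := by
    intro a
    rw [𝓔.bracket_skew, ContMDiffSection.coe_neg, Pi.neg_apply,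
      𝓔.bracket_congr_right τ (frame I F E q₁ a)
      (∑ i, smulSection (A a i) (frame I F E q₀ i)) (pr p) (by
        filter_upwards [hA a] with q hq
        rw [hq, sum_section_apply]
        rfl), 𝓔.bracket_sum_right, sum_section_apply, ← Finset.sum_neg_distrib]
    refine Finset.sum_congr rfl fun i _ => ?_
    rw [𝓔.leibniz', 𝓔.bracket_skew τ]
    change -(A a i (pr p) • -(𝓔.bracket (frame I F E q₀ i) τ (pr p)) +
      𝓔.anchorDeriv τ (A a i) (pr p) • frame I F E q₀ i (pr p)) = _
    module
  have hco : ∀ i, Z.coeff q₀ i =ᶠ[𝓝 p] fun p' => ∑ a, Z.coeff q₁ a p' * (A a i ∘ pr) p' := by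
    intro i
    filter_upwards [hpr.continuous.continuousAt.eventually h₀,
      hpr.continuous.continuousAt.eventually h₁] with p' h h'
    exact Z.coeff_eq_sum q₀ q₁ i p' h h'
  have hder : ∀ i, mvfderiv IP (Z.coeff q₀ i) p X = ∑ a, (mvfderiv IP (Z.coeff q₁ a) p X *
      A a i (pr p) + Z.coeff q₁ a p * 𝓔.anchorDeriv τ (A a i) (pr p)) := by
    intro i
    rw [mvfderiv_congr (hco i), mvfderiv_finset_sum, _root_.sum_apply]
    · refine Finset.sum_congr rfl fun a _ => ?_
      have hm := mvfderiv_mul (hd (Z.contMDiff_coeff q₁ a)) (hd ((A a i).contMDiff.comp hpr))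
      have hm' := congrArg (fun T => T X) hm
      refine hm'.trans ?_
      have h3 : mvfderiv IP (A a i ∘ pr) p X = 𝓔.anchorDeriv τ (A a i) (pr p) := by
        rw [mvfderiv_comp_apply p (((A a i).contMDiff _).mdifferentiableAt (by simp))
          ((hpr p).mdifferentiableAt (by simp)), ← hX]
        rfl
      simp only [_root_.add_apply, _root_.smul_apply, smul_eq_mul, Function.comp_apply]
      rw [h3]
      ring
    · exact fun a => hd ((Z.contMDiff_coeff q₁ a).mul ((A a i).contMDiff.comp hpr))
  have hc0 : ∀ i, Z.coeff q₀ i p = ∑ a, Z.coeff q₁ a p * A a i (pr p) :=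
    fun i => (hco i).self_of_nhds
  simp only [hbr, hder, hc0]
  have hA0 : ∀ a, frame I F E q₁ a (pr p) = ∑ i, A a i (pr p) • frame I F E q₀ i (pr p) :=
    fun a => (hA a).self_of_nhds
  simp only [hA0, Finset.smul_sum, Finset.sum_smul]
  rw [← Finset.sum_sub_distrib, Finset.sum_comm (f := fun i a =>
    (Z.coeff q₁ a p * A a i (pr p)) • 𝓔.bracket (frame I F E q₀ i) τ (pr p)),
    Finset.sum_comm (f := fun i a => (mvfderiv IP (Z.coeff q₁ a) p X *
      A a i (pr p) + Z.coeff q₁ a p * 𝓔.anchorDeriv τ (A a i) (pr p)) • frame I F E q₀ i (pr p)),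
    ← Finset.sum_sub_distrib]
  refine Finset.sum_congr rfl fun a _ => ?_
  rw [← Finset.sum_sub_distrib, ← Finset.sum_sub_distrib]
  refine Finset.sum_congr rfl fun i _ => ?_
  module

/-- The formula for the bracket does not depend on the frame. -/
theorem bracketFst_frame (hpr : ContMDiff IP I ∞ pr) (Z₁ Z₂ : 𝓔.ProlongationSection IP pr)
    (q₀ q₁ : Q) (p : P)
    (h₀ : ∀ᶠ q in 𝓝 (pr p), bump I F E q₀ q = 1) (h₁ : ∀ᶠ q in 𝓝 (pr p), bump I F E q₁ q = 1) :
    bracketFst Z₁ Z₂ q₁ p = bracketFst Z₁ Z₂ q₀ p := by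
  let τ : ∀ (_ : 𝓔.ProlongationSection IP pr) (_ : Q), Cₛ^∞⟮I; F, E⟯ := fun Z q =>
    ∑ j, Z.coeff q j p • frame I F E q j
  have hτ : ∀ (Z : 𝓔.ProlongationSection IP pr) (q : Q), bump I F E q (pr p) = 1 →
      𝓔.anchor (pr p) (τ Z q (pr p)) = mfderiv IP I pr p (Z.vec p) := by
    intro Z q hq
    rw [sum_section_apply, ← Z.anchor_fst, Z.fst_eq q p hq]
    rfl
  have hbr : ∀ (Z : 𝓔.ProlongationSection IP pr) (q : Q) (σ : Cₛ^∞⟮I; F, E⟯),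
      𝓔.bracket σ (τ Z q) (pr p) = ∑ j, Z.coeff q j p • 𝓔.bracket σ (frame I F E q j) (pr p) := by
    intro Z q σ
    rw [𝓔.bracket_sum_right, sum_section_apply]
    refine Finset.sum_congr rfl fun j _ => ?_
    rw [𝓔.bracket_smul_right]
    rfl
  have e1 := half_bracket_eq hpr Z₁ q₀ q₁ p h₀ h₁ (τ Z₂ q₁) (Z₂.vec p) (hτ Z₂ q₁ h₁.self_of_nhds)
  have e2 := half_bracket_eq hpr Z₂ q₀ q₁ p h₀ h₁ (τ Z₁ q₀) (Z₁.vec p) (hτ Z₁ q₀ h₀.self_of_nhds)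
  have sw : ∀ q q', (∑ i, Z₂.coeff q i p • 𝓔.bracket (frame I F E q i) (τ Z₁ q') (pr p)) =
      -∑ i, Z₁.coeff q' i p • 𝓔.bracket (frame I F E q' i) (τ Z₂ q) (pr p) := by
    intro q q'
    simp only [hbr, Finset.smul_sum]
    rw [Finset.sum_comm, ← Finset.sum_neg_distrib]
    refine Finset.sum_congr rfl fun j _ => ?_
    rw [← Finset.sum_neg_distrib]
    refine Finset.sum_congr rfl fun i _ => ?_
    rw [𝓔.bracket_skew, ContMDiffSection.coe_neg, Pi.neg_apply, smul_neg, smul_neg, smul_comm]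
  have hb : ∀ q, bracketFst Z₁ Z₂ q p =
      (∑ i, Z₁.coeff q i p • 𝓔.bracket (frame I F E q i) (τ Z₂ q) (pr p)) +
    (∑ j, mvfderiv IP (Z₂.coeff q j) p (Z₁.vec p) • frame I F E q j (pr p)) -
    ∑ i, mvfderiv IP (Z₁.coeff q i) p (Z₂.vec p) • frame I F E q i (pr p) := by
    intro q
    simp only [bracketFst, hbr, Finset.smul_sum, smul_smul]
  rw [hb, hb]
  rw [sw, sw] at e2
  rw [add_sub_right_comm, e1, add_sub_right_comm]
  have e2' := congrArg Neg.neg e2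
  simp only [neg_sub, sub_neg_eq_add] at e2'
  rw [add_comm, add_comm (∑ i, mvfderiv IP (Z₂.coeff q₀ i) p (Z₁.vec p) • _)] at e2'
  rw [sub_add_eq_add_sub, sub_add_eq_add_sub, add_comm, add_comm (∑ i, Z₁.coeff q₀ i p • _),
    sub_left_inj]
  rw [add_comm, add_comm (∑ i, mvfderiv IP (Z₂.coeff q₀ i) p (Z₁.vec p) • _)]
  exact e2'

theorem eventually_bump_eq_one (q₀ : Q) : ∀ᶠ q in 𝓝 q₀, bump I F E q₀ q = 1 :=
  (bump I F E q₀).eventuallyEq_one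

theorem contMDiffAt_bracketFst (hpr : ContMDiff IP I ∞ pr) (Z₁ Z₂ : 𝓔.ProlongationSection IP pr)
    (q₀ : Q) (p₀ : P) : ContMDiffAt IP (I.prod 𝓘(ℝ, F)) ∞
      (fun p => (⟨pr p, bracketFst Z₁ Z₂ q₀ p⟩ : TotalSpace F E)) p₀ := by
  rw [contMDiffAt_totalSpace]
  refine ⟨hpr p₀, ?_⟩
  let e := trivializationAt F E (pr p₀)
  have hσ : ∀ σ : Cₛ^∞⟮I; F, E⟯, ContMDiffAt IP 𝓘(ℝ, F) ∞
      (fun p => e.linearMapAt ℝ (pr p) (σ (pr p))) p₀ := by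
    intro σ
    have h1 := (contMDiffAt_totalSpace.1 ((σ.contMDiff.comp hpr) p₀)).2
    refine h1.congr_of_eventuallyEq ?_
    filter_upwards [hpr.continuous.continuousAt.eventually
      (e.open_baseSet.mem_nhds (mem_baseSet_trivializationAt F E (pr p₀)))] with p hp
    have hp' : pr p ∈ e.baseSet := hp
    rw [e.linearMapAt_apply, if_pos hp']
    rfl
  have hc := fun (Z : 𝓔.ProlongationSection IP pr) i => Z.contMDiff_coeff q₀ i
  have hdc := fun (Z Z' : 𝓔.ProlongationSection IP pr) i =>
    contMDiff_mvfderiv_apply _ (hc Z i) _ Z'.contMDiff_vec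
  have h2 : ContMDiffAt IP 𝓘(ℝ, F) ∞
      (fun p => e.linearMapAt ℝ (pr p) (bracketFst Z₁ Z₂ q₀ p)) p₀ := by
    simp only [bracketFst, map_add, map_sub, map_sum, map_smul]
    refine ContMDiffAt.sub (ContMDiffAt.add ?_ ?_) ?_
    · refine contMDiffAt_finsetSum fun i _ => contMDiffAt_finsetSum fun j _ => ?_
      exact (((hc Z₁ i).mul (hc Z₂ j)) p₀).smul (hσ _)
    · exact contMDiffAt_finsetSum fun j _ => ((hdc Z₂ Z₁ j) p₀).smul (hσ _)
    · exact contMDiffAt_finsetSum fun j _ => ((hdc Z₁ Z₂ j) p₀).smul (hσ _)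
  refine h2.congr_of_eventuallyEq ?_
  filter_upwards [hpr.continuous.continuousAt.eventually
    (e.open_baseSet.mem_nhds (mem_baseSet_trivializationAt F E (pr p₀)))] with p hp
  have hp' : pr p ∈ e.baseSet := hp
  rw [e.linearMapAt_apply, if_pos hp']

variable [I.Boundaryless] [FiniteDimensional ℝ EP] [IP.Boundaryless]

/-- The Lie bracket of two sections of the prolongation. -/
def bracket (hpr : ContMDiff IP I ∞ pr) (Z₁ Z₂ : 𝓔.ProlongationSection IP pr) :
    𝓔.ProlongationSection IP pr where
  fst p := bracketFst Z₁ Z₂ (pr p) p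
  vec p := mlieBracket IP Z₁.vec Z₂.vec p
  contMDiff_fst := by
    intro p₀
    refine (contMDiffAt_bracketFst hpr Z₁ Z₂ (pr p₀) p₀).congr_of_eventuallyEq ?_
    filter_upwards [hpr.continuous.continuousAt.eventually
      (eventually_bump_eq_one (I := I) (F := F) (E := E) (pr p₀)).eventually_nhds] with p hp
    rw [bracketFst_frame hpr Z₁ Z₂ (pr p₀) (pr p) p hp (eventually_bump_eq_one _)]
  contMDiff_vec := by
    have := FiniteDimensional.complete ℝ EP
    have : IsManifold IP (minSmoothness ℝ 2) P := by
      rw [minSmoothness_of_isRCLikeNormedField]; infer_instance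
    have : IsManifold IP (((⊤ : ℕ∞) : ℕ∞ω) + 1) P := by
      rw [show (((⊤ : ℕ∞) : ℕ∞ω) + 1) = ∞ from rfl]; infer_instance
    intro p
    exact ContMDiffAt.mlieBracket_vectorField (m := ⊤) (n := ⊤) (Z₁.contMDiff_vec p)
      (Z₂.contMDiff_vec p) (by simp)
  anchor_fst p := anchor_bracketFst hpr Z₁ Z₂ (pr p) p (eventually_bump_eq_one _)

end ProlongationSection

end LieAlgebroid
namespace LieAlgebroid

variable {I F E} [IsManifold I ∞ Q] (𝓔 : LieAlgebroid I F E)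

/-- The Lie algebroid `E`, with its space of smooth sections. -/
def data : BracketData I E where
  Sec := Cₛ^∞⟮I; F, E⟯
  eval σ q := σ q
  anchor := 𝓔.anchor
  bracket := 𝓔.bracket

/-- The differential `d^E f` of a function, `(d^E f)(a) = ρ(a) f`. -/
def differential (f : C^∞⟮I, Q; ℝ⟯) (q : Q) : E q →ₗ[ℝ] ℝ :=
  (mvfderiv I f q).toLinearMap ∘ₗ 𝓔.anchor q

/-- The prolongation of `E` over `pr : P → Q`. Its anchor is the projection `(a, v) ↦ v`. -/
def prolongationData {EP : Type*} [NormedAddCommGroup EP] [NormedSpace ℝ EP]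
    [FiniteDimensional ℝ EQ] [T2Space Q] [FiniteDimensional ℝ F] [ContMDiffVectorBundle ∞ F E I]
    [I.Boundaryless]
    {HP : Type*} [TopologicalSpace HP] (IP : ModelWithCorners ℝ EP HP)
    {P : Type*} [TopologicalSpace P] [ChartedSpace HP P] [IsManifold IP ∞ P]
    [FiniteDimensional ℝ EP] [IP.Boundaryless] {pr : P → Q} (hpr : ContMDiff IP I ∞ pr) :
    BracketData IP (fun p => 𝓔.prolongation IP pr p) where
  Sec := 𝓔.ProlongationSection IP pr
  eval Z := Z.eval
  anchor p := LinearMap.snd ℝ _ _ ∘ₗ (𝓔.prolongation IP pr p).subtype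
  bracket := ProlongationSection.bracket hpr

end LieAlgebroid

/-! ### The bundle `E* × ℝ` and its contact section -/

section Contact

/-- The fibres of the dual bundle `E*`. -/
abbrev DualFiber (q : Q) : Type _ := E q →L[ℝ] Trivial Q ℝ q

/-- The manifold `E* × ℝ`. -/
abbrev DualR : Type _ := TotalSpace (F →L[ℝ] ℝ) (DualFiber E) × ℝ

/-- The model of the manifold `E* × ℝ`. -/
abbrev dualModel : ModelWithCorners ℝ ((EQ × (F →L[ℝ] ℝ)) × ℝ)
    (ModelProd (ModelProd HQ (F →L[ℝ] ℝ)) ℝ) :=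
  (I.prod 𝓘(ℝ, F →L[ℝ] ℝ)).prod 𝓘(ℝ, ℝ)

variable [∀ q, IsTopologicalAddGroup (E q)] [∀ q, ContinuousSMul ℝ (E q)]
  [IsManifold I ∞ Q] [ContMDiffVectorBundle ∞ F E I]

variable {F E} in
/-- The projection `E* × ℝ → Q`. -/
def dualProj (p : DualR F E) : Q := p.1.proj

theorem contMDiff_dualProj : ContMDiff (dualModel I F) I ∞ (dualProj : DualR F E → Q) :=
  (contMDiff_proj (DualFiber E)).comp contMDiff_fst

variable {I F E}

/-- The section `γ = (γ₀, γₛ)` of `E* × ℝ → Q` with components `γ₀ ∈ Γ(E*)` and `γₛ ∈ C^∞(Q)`. -/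
def dualSection (γ₀ : Cₛ^∞⟮I; F →L[ℝ] ℝ, DualFiber E⟯) (γs : C^∞⟮I, Q; ℝ⟯) (q : Q) : DualR F E :=
  (⟨q, γ₀ q⟩, γs q)

theorem contMDiff_dualSection (γ₀ : Cₛ^∞⟮I; F →L[ℝ] ℝ, DualFiber E⟯) (γs : C^∞⟮I, Q; ℝ⟯) :
    ContMDiff I (dualModel I F) ∞ (dualSection γ₀ γs) :=
  γ₀.contMDiff.prodMk γs.contMDiff

namespace LieAlgebroid

variable (𝓔 : LieAlgebroid I F E)

/-- The fibres of the prolongation of `E` over `E* × ℝ → Q`. -/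
abbrev contactProlongation (p : DualR F E) :
    Submodule ℝ (E (dualProj p) × TangentSpace (dualModel I F) p) :=
  𝓔.prolongation (dualModel I F) dualProj p

/-- The prolongation of `E` over `E* × ℝ → Q`. -/
def contactProlongationData [FiniteDimensional ℝ EQ] [T2Space Q] [FiniteDimensional ℝ F]
    [I.Boundaryless] : BracketData (dualModel I F) (fun p => 𝓔.contactProlongation p) :=
  𝓔.prolongationData (dualModel I F) (contMDiff_dualProj I F E)

/-- The bundle map `(Id_E, Tγ ∘ ρ)` over `γ`, `a ↦ (a, Tγ(ρ(a)))`. -/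
def liftMap (γ₀ : Cₛ^∞⟮I; F →L[ℝ] ℝ, DualFiber E⟯) (γs : C^∞⟮I, Q; ℝ⟯) (q : Q) :
    E q →ₗ[ℝ] 𝓔.contactProlongation (dualSection γ₀ γs q) :=
  LinearMap.codRestrict _
    (LinearMap.prod (LinearMap.id (R := ℝ) (M := E q))
      ((mfderiv I (dualModel I F) (dualSection γ₀ γs) q).toLinearMap ∘ₗ 𝓔.anchor q)) (by
    intro a
    change 𝓔.anchor q a = mfderiv (dualModel I F) I dualProj (dualSection γ₀ γs q)
      (mfderiv I (dualModel I F) (dualSection γ₀ γs) q (𝓔.anchor q a))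
    rw [← mfderiv_comp_apply q (((contMDiff_dualProj I F E) _).mdifferentiableAt (by simp))
      (((contMDiff_dualSection γ₀ γs) q).mdifferentiableAt (by simp))]
    have h : dualProj ∘ dualSection γ₀ γs = (id : Q → Q) := rfl
    rw [h, mfderiv_id]
    rfl)

/-- The Liouville section `Θ_{(b, s)}(a, v) = b(a)`. -/
def liouvilleSection (p : DualR F E) : 𝓔.contactProlongation p →ₗ[ℝ] ℝ :=
  ((p.1.2).toLinearMap ∘ₗ LinearMap.fst ℝ _ _) ∘ₗ (𝓔.contactProlongation p).subtype

/-- The section `𝒱ˢ` dual to `∂/∂s`, that is `(a, v) ↦ ds(v)` where `s : E* × ℝ → ℝ` is the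
projection. -/
def vSection (p : DualR F E) : 𝓔.contactProlongation p →ₗ[ℝ] ℝ :=
  ((mvfderiv (dualModel I F) (Prod.snd : DualR F E → ℝ) p).toLinearMap ∘ₗ LinearMap.snd ℝ _ _) ∘ₗ
    (𝓔.contactProlongation p).subtype

/-- The contact section `η = 𝒱ˢ - Θ`, as a `1`-form on the prolongation. -/
def contactForm (p : DualR F E) : 𝓔.contactProlongation p [⋀^Fin 1]→ₗ[ℝ] ℝ :=
  AlternatingMap.ofSubsingleton ℝ _ ℝ 0 (𝓔.vSection p - 𝓔.liouvilleSection p)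

end LieAlgebroid

end Contact

end Algebroid

end

/-! Write Φ for the lift a ↦ (a, Tγ(ρ(a))). The morphism condition compares d(Φ*μ) at x with dμ at
γ(x), where the sections Zᵢ of the prolongation need only agree with Φσᵢ at the single point γ(x).
So Zᵢ and σᵢ are not related near x, and the individual terms of the two Koszul formulas differ. The
proof computes these differences and shows that they cancel.

Near γ(x), finitely many sections W_b span the prolongation. Write Φσᵢ = Σ cᵢᵇ W_b∘γ near x and Zᵢ =
Σ gᵢᵇ W_b near γ(x), with cᵢᵇ = gᵢᵇ∘γ at x, and put Δᵢⱼ = Σ_b ρ(σᵢ)(cⱼᵇ - gⱼᵇ∘γ) W_b, evaluated at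
x. By the product rule the i-th anchor terms differ by the sum, over the remaining arguments j, of μ
with the j-th argument replaced by Δᵢⱼ (`mvfderiv_apply_frame_sub`). The brackets satisfy Φ[σᵢ, σⱼ]
- [Zᵢ, Zⱼ] = Δᵢⱼ - Δⱼᵢ at γ(x) (`LieAlgebroid.liftMap_bracket_sub`). With these values the two kinds
of error cancel for every alternating form, which is pure sign bookkeeping
(`sum_update_add_sum_cons_eq_zero`). `extDeriv_pullbackForm_of_frame` assembles the three facts.

The bracket identity is checked on the two components. On the E-component both brackets are expanded
in a local frame of E: the terms with structure functions agree, because the coefficients agree at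
the point, and only the derivative terms survive. On the tangent component both sides act on a test
function; there ρ[σ₁, σ₂] is the commutator of ρ(σ₁) and ρ(σ₂), which follows from the Leibniz rule
and the Jacobi identity.

The spanning sections exist because the projection E* × ℝ → Q is linear in suitable charts
(`exists_frame_contactProlongation`). The formula for the pullback of η is the chain rule for s∘γ =
γₛ. -/

noncomputable section

/-! ### Cancellation of error terms in the Koszul formula -/

section Koszul

/-- The identity behind the tensoriality of the Koszul formula for the exterior differential. -/
theorem sum_update_add_sum_cons_eq_zero {V : Type*} [AddCommGroup V] [Module ℝ V] {k : ℕ}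
    (μ : V [⋀^Fin (k + 1)]→ₗ[ℝ] ℝ) (v : Fin (k + 2) → V) (D : Fin (k + 2) → Fin (k + 2) → V) :
    (∑ i : Fin (k + 2), (-1 : ℝ) ^ (i : ℕ) * ∑ l : Fin (k + 1),
      μ (Function.update (fun m => v (i.succAbove m)) l (D i (i.succAbove l)))) +
    (∑ j : Fin (k + 2), ∑ i : Fin (k + 1), if i.castSucc < j then
      (-1 : ℝ) ^ ((i : ℕ) + (j : ℕ)) * μ (Fin.cons (D i.castSucc j - D j i.castSucc)
        (fun l : Fin k => v (j.succAbove (i.succAbove l)))) else 0) = 0 := by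
  -- Moving the replaced argument from slot `l` to the front costs the sign `(-1) ^ l`.
  have h1 : ∀ (i : Fin (k + 2)) (l : Fin (k + 1)),
      μ (Function.update (fun m => v (i.succAbove m)) l (D i (i.succAbove l))) =
        (-1) ^ (l : ℕ) * μ (Matrix.vecCons (D i (i.succAbove l))
          (l.removeNth (i.removeNth v))) := by
    intro i l
    have h := μ.map_insertNth l (D i (i.succAbove l)) (l.removeNth (i.removeNth v))
    rw [Fin.insertNth_removeNth] at h
    refine h.trans ?_
    simp
  simp only [h1, Finset.mul_sum]
  -- The triangle formula groups the two ways to obtain an unordered pair of indices: omit `i` and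
  -- replace `j + 1`, or omit `j + 1` and replace `i`, for `i ≤ j`. In the bracket sum the term `j =
  -- 0` is split off, since no index lies below it.
  rw [Fin.sum_sum_eq_sum_triangle_add, Fin.sum_univ_succ (n := k + 1)]
  simp only [Fin.not_lt_zero, if_false, Finset.sum_const_zero, zero_add]
  rw [Finset.sum_comm (s := (Finset.univ : Finset (Fin (k + 1))))
    (t := (Finset.univ : Finset (Fin (k + 1)))), ← Finset.sum_add_distrib]
  refine Finset.sum_eq_zero fun i _ => ?_
  rw [← Finset.sum_filter]
  have hf : (Finset.univ.filter fun j : Fin (k + 1) => i.castSucc < j.succ) = Finset.Ici i := by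
    ext j
    simp [Fin.castSucc_lt_succ_iff]
  rw [hf, ← Finset.sum_add_distrib]
  refine Finset.sum_eq_zero fun j hj => ?_
  rw [Finset.mem_Ici] at hj
  have H₁ : i.castSucc.succAbove j = j.succ := by simp [Fin.succAbove_of_le_castSucc, hj]
  have H₂ : j.predAbove i.castSucc = i := by simp [Fin.predAbove_of_le_castSucc, hj]
  have H₃ : j.succ.succAbove i = i.castSucc := by simp [Fin.succAbove_of_castSucc_lt, hj]
  have hs : ∀ (a b : V) (w : Fin k → V), μ (Fin.cons (a - b) w) =
      μ (Matrix.vecCons a w) - μ (Matrix.vecCons b w) := by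
    intro a b w
    exact congrArg (fun T => T w) (μ.toMultilinearMap.curryLeft.map_sub a b)
  -- The remaining arguments do not depend on the order of removal, so all terms of a pair have the
  -- same tail. The signs `(-1)^(i+j)`, `(-1)^(i+j+1)` and, for the bracket, `(-1)^(i+j+1)` then
  -- cancel.
  rw [Fin.removeNth_removeNth_eq_swap, H₁, H₂, H₃, hs]
  have e : (fun l : Fin k => v (j.succ.succAbove (i.succAbove l))) =
      i.removeNth (j.succ.removeNth v) := rfl
  rw [e]
  simp only [Fin.val_castSucc, Fin.val_succ]
  ring

end Koszul

/-! ### Derivatives of forms evaluated on a spanning family -/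

section FrameDerivative

variable {EM : Type*} [NormedAddCommGroup EM] [NormedSpace ℝ EM]
  {HM : Type*} [TopologicalSpace HM] {I : ModelWithCorners ℝ EM HM}
  {M : Type*} [TopologicalSpace M] [ChartedSpace HM M] [IsManifold I ∞ M]
  {N : Type*} {B : N → Type*} [∀ y, AddCommGroup (B y)] [∀ y, Module ℝ (B y)]
  {ι : Type*} [Fintype ι]

/-- Multilinear expansion over all index maps, repetitions included. Linear independence of `W`
plays no role, so the expansion applies to redundant spanning families. -/
theorem AlternatingMap.apply_sum_smul {V : Type*} [AddCommGroup V] [Module ℝ V] {k : ℕ}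
    (μ : V [⋀^Fin k]→ₗ[ℝ] ℝ) (c : Fin k → ι → ℝ) (W : ι → V) :
    μ (fun l => ∑ a, c l a • W a) = ∑ β : Fin k → ι, (∏ l, c l (β l)) * μ (fun l => W (β l)) := by
  classical
  have h := μ.toMultilinearMap.map_sum (fun l a => c l a • W a)
  refine h.trans (Finset.sum_congr rfl fun β _ => ?_)
  exact μ.toMultilinearMap.map_smul_univ _ _

theorem mvfderiv_finset_prod {k : ℕ} (c : Fin k → M → ℝ) (x : M)
    (hc : ∀ l, MDifferentiableAt I 𝓘(ℝ, ℝ) (c l) x) (v : TangentSpace I x) :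
    MDifferentiableAt I 𝓘(ℝ, ℝ) (fun y => ∏ l, c l y) x ∧
    mvfderiv I (fun y => ∏ l, c l y) x v =
      ∑ l, (∏ m ∈ Finset.univ.erase l, c m x) * mvfderiv I (c l) x v := by
  have h := HasMFDerivAt.prod (t := Finset.univ) (f := c) (z := x)
    (f' := fun l => mvfderiv I (c l) x) fun l _ => (hc l).hasMFDerivAt
  have e : (∏ l, c l) = fun y => ∏ l, c l y := by ext y; simp
  rw [e] at h
  refine ⟨h.mdifferentiableAt, ?_⟩
  have h2 : mvfderiv I (fun y => ∏ l, c l y) x =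
      ∑ l, (∏ m ∈ Finset.univ.erase l, c m x) • mvfderiv I (c l) x := h.mfderiv
  rw [h2]
  simp

/-- How the derivative of the value of a form on linear combinations of a frame depends on the
derivatives of the coefficients. -/
theorem mvfderiv_apply_frame_sub (f : M → N) {k : ℕ} (μ : ∀ y, B y [⋀^Fin k]→ₗ[ℝ] ℝ)
    (W : ι → ∀ y, B y) (x : M)
    (hm : ∀ β : Fin k → ι, MDifferentiableAt I 𝓘(ℝ, ℝ)
      (fun y => μ (f y) (fun l => W (β l) (f y))) x)
    (c c' : Fin k → ι → M → ℝ) (hc : ∀ l a, MDifferentiableAt I 𝓘(ℝ, ℝ) (c l a) x)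
    (hc' : ∀ l a, MDifferentiableAt I 𝓘(ℝ, ℝ) (c' l a) x) (hcc : ∀ l a, c l a x = c' l a x)
    (v : TangentSpace I x) :
    mvfderiv I (fun y => μ (f y) (fun l => ∑ a, c l a y • W a (f y))) x v -
      mvfderiv I (fun y => μ (f y) (fun l => ∑ a, c' l a y • W a (f y))) x v =
    ∑ l, μ (f x) (Function.update (fun m => ∑ a, c m a x • W a (f x)) l
      (∑ a, (mvfderiv I (c l a) x v - mvfderiv I (c' l a) x v) • W a (f x))) := by
  classical
  -- Product rule in the expansion. The part that differentiates `μ (W β)` contains only the values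
  -- of the coefficients at `x`, so it is the same for `c` and `c'` and drops out of the difference.
  have key : ∀ c : Fin k → ι → M → ℝ, (∀ l a, MDifferentiableAt I 𝓘(ℝ, ℝ) (c l a) x) →
      mvfderiv I (fun y => μ (f y) (fun l => ∑ a, c l a y • W a (f y))) x v =
        ∑ β : Fin k → ι, ((∏ l, c l (β l) x) *
            mvfderiv I (fun y => μ (f y) (fun l => W (β l) (f y))) x v +
          μ (f x) (fun l => W (β l) (f x)) *
            ∑ l, (∏ m ∈ Finset.univ.erase l, c m (β m) x) * mvfderiv I (c l (β l)) x v) := by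
    intro c hc
    have hp := fun β : Fin k → ι => mvfderiv_finset_prod (fun l => c l (β l)) x (fun l => hc _ _) v
    have e : (fun y => μ (f y) (fun l => ∑ a, c l a y • W a (f y))) =
        fun y => ∑ β : Fin k → ι, (∏ l, c l (β l) y) * μ (f y) (fun l => W (β l) (f y)) :=
      funext fun y => AlternatingMap.apply_sum_smul _ _ _
    have hsum := mvfderiv_finset_sum (I := I) Finset.univ
      (fun (β : Fin k → ι) y => (∏ l, c l (β l) y) * μ (f y) (fun l => W (β l) (f y))) x
      fun β => (hp β).1.mul (hm β)
    rw [e, hsum, _root_.sum_apply]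
    refine Finset.sum_congr rfl fun β _ => ?_
    have h := congrArg (fun T => T v) (mvfderiv_mul (hp β).1 (hm β))
    refine h.trans ?_
    simp only [_root_.add_apply, _root_.smul_apply, smul_eq_mul, (hp β).2]
  have hu : ∀ l, μ (f x) (Function.update (fun m => ∑ a, c m a x • W a (f x)) l
      (∑ a, (mvfderiv I (c l a) x v - mvfderiv I (c' l a) x v) • W a (f x))) =
      ∑ β : Fin k → ι, ((∏ m ∈ Finset.univ.erase l, c m (β m) x) *
        (mvfderiv I (c l (β l)) x v - mvfderiv I (c' l (β l)) x v)) *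
          μ (f x) (fun l => W (β l) (f x)) := by
    intro l
    -- Replacing the `l`-th argument of the form amounts to replacing the `l`-th row of the
    -- coefficient matrix.
    let C : Fin k → ι → ℝ := Function.update (fun m a => c m a x) l
      (fun a => mvfderiv I (c l a) x v - mvfderiv I (c' l a) x v)
    have e : Function.update (fun m => ∑ a, c m a x • W a (f x)) l
        (∑ a, (mvfderiv I (c l a) x v - mvfderiv I (c' l a) x v) • W a (f x)) =
        fun m => ∑ a, C m a • W a (f x) := by
      ext m
      by_cases h : m = l
      · subst h; simp [C]
      · simp [C, h]
    rw [e, AlternatingMap.apply_sum_smul]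
    refine Finset.sum_congr rfl fun β _ => ?_
    rw [← Finset.mul_prod_erase _ _ (Finset.mem_univ l), mul_comm (C l (β l))]
    congr 2
    · refine Finset.prod_congr rfl fun m hm => ?_
      simp [C, Finset.ne_of_mem_erase hm]
    · simp [C]
  rw [key c hc, key c' hc', Finset.sum_congr rfl fun l _ => hu l, Finset.sum_comm,
    ← Finset.sum_sub_distrib]
  refine Finset.sum_congr rfl fun β _ => ?_
  simp only [← hcc, mul_sub, sub_mul, Finset.sum_sub_distrib, Finset.mul_sum]
  simp only [mul_comm (μ (f x) _)]
  ring

end FrameDerivative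

/-! ### A local criterion for compatibility with the differentials -/

section Morphism

variable {EM : Type*} [NormedAddCommGroup EM] [NormedSpace ℝ EM]
  {HM : Type*} [TopologicalSpace HM] {I : ModelWithCorners ℝ EM HM}
  {M : Type*} [TopologicalSpace M] [ChartedSpace HM M] [IsManifold I ∞ M]
  {EN : Type*} [NormedAddCommGroup EN] [NormedSpace ℝ EN]
  {HN : Type*} [TopologicalSpace HN] {J : ModelWithCorners ℝ EN HN}
  {N : Type*} [TopologicalSpace N] [ChartedSpace HN N]
  {A : M → Type*} [∀ x, AddCommGroup (A x)] [∀ x, Module ℝ (A x)]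
  {B : N → Type*} [∀ y, AddCommGroup (B y)] [∀ y, Module ℝ (B y)]
  {ι : Type*} [Fintype ι]

/-- A bundle map commutes with the exterior differential at `x` if it is compatible with the
anchors and the brackets, both expressed in a local frame of the target. -/
theorem extDeriv_pullbackForm_of_frame (D : BracketData I A) (D' : BracketData J B) (f : M → N)
    (Φ : ∀ x, A x →ₗ[ℝ] B (f x)) (x : M) (hf : MDifferentiableAt I J f x) (W : ι → D'.Sec)
    {k : ℕ} (μ : ∀ y, B y [⋀^Fin k]→ₗ[ℝ] ℝ) (hμ : D'.IsSmoothForm μ)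
    (σ : Fin (k + 1) → D.Sec) (Z : Fin (k + 1) → D'.Sec)
    (c : Fin (k + 1) → ι → M → ℝ) (g : Fin (k + 1) → ι → N → ℝ)
    (hc : ∀ l a, MDifferentiableAt I 𝓘(ℝ, ℝ) (c l a) x)
    (hg : ∀ l a, MDifferentiableAt J 𝓘(ℝ, ℝ) (g l a) (f x))
    (hcg : ∀ l a, c l a x = g l a (f x))
    (hσ : ∀ l, ∀ᶠ y in 𝓝 x, Φ y (D.eval (σ l) y) = ∑ a, c l a y • D'.eval (W a) (f y))
    (hZ : ∀ l, ∀ᶠ z in 𝓝 (f x), D'.eval (Z l) z = ∑ a, g l a z • D'.eval (W a) z)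
    (hanchor : ∀ i, D'.anchor (f x) (D'.eval (Z i) (f x)) =
      mfderiv I J f x (D.anchor x (D.eval (σ i) x)))
    (hbr : ∀ i j, Φ x (D.eval (D.bracket (σ i) (σ j)) x) -
        D'.eval (D'.bracket (Z i) (Z j)) (f x) =
      (∑ a, (mvfderiv I (c j a) x (D.anchor x (D.eval (σ i) x)) -
        mvfderiv I (g j a ∘ f) x (D.anchor x (D.eval (σ i) x))) • D'.eval (W a) (f x)) -
      ∑ a, (mvfderiv I (c i a) x (D.anchor x (D.eval (σ j) x)) -
        mvfderiv I (g i a ∘ f) x (D.anchor x (D.eval (σ j) x))) • D'.eval (W a) (f x)) :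
    D.extDeriv (pullbackForm f Φ μ) σ x = D'.extDeriv μ Z (f x) := by
  -- `Δ i j` measures how far the `j`-th sections fail to agree to first order along the anchor of
  -- `σ i`.
  let Δ : Fin (k + 1) → Fin (k + 1) → B (f x) := fun i j =>
    ∑ a, (mvfderiv I (c j a) x (D.anchor x (D.eval (σ i) x)) -
        mvfderiv I (g j a ∘ f) x (D.anchor x (D.eval (σ i) x))) • D'.eval (W a) (f x)
  let v : Fin (k + 1) → B (f x) := fun i => Φ x (D.eval (σ i) x)
  have hfc : ContinuousAt f x := hf.continuousAt
  have hvc : ∀ i, v i = ∑ a, c i a x • D'.eval (W a) (f x) := fun i => (hσ i).self_of_nhds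
  have hv : ∀ i, D'.eval (Z i) (f x) = v i := by
    intro i
    rw [(hZ i).self_of_nhds, hvc]
    simp only [hcg]
  have hder : ∀ i : Fin (k + 1),
      mvfderiv I (fun y => pullbackForm f Φ μ y (fun l => D.eval (σ (i.succAbove l)) y)) x
        (D.anchor x (D.eval (σ i) x)) -
      mvfderiv J (fun y => μ y (fun l => D'.eval (Z (i.succAbove l)) y)) (f x)
        (D'.anchor (f x) (D'.eval (Z i) (f x))) =
      ∑ l, μ (f x) (Function.update (fun m => v (i.succAbove m)) l (Δ i (i.succAbove l))) := by
    intro i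
    have e1 : (fun y => pullbackForm f Φ μ y (fun l => D.eval (σ (i.succAbove l)) y)) =ᶠ[𝓝 x]
        fun y => μ (f y) (fun l => ∑ a, c (i.succAbove l) a y • D'.eval (W a) (f y)) := by
      filter_upwards [eventually_all.2 fun l => hσ (i.succAbove l)] with y hy
      simp only [pullbackForm, AlternatingMap.compLinearMap_apply, ← hy]
    have e2 : (fun y => μ y (fun l => D'.eval (Z (i.succAbove l)) y)) ∘ f =ᶠ[𝓝 x]
        fun y => μ (f y) (fun l => ∑ a, (g (i.succAbove l) a ∘ f) y • D'.eval (W a) (f y)) := by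
      filter_upwards [eventually_all.2 fun l => hfc.eventually (hZ (i.succAbove l))] with y hy
      simp only [Function.comp_apply, hy]
    -- Since the anchors correspond at `x`, the derivative on the target becomes a derivative on `M`
    -- of the composite with `f`. Both functions are then expansions in the same `W b ∘ f`.
    rw [hanchor, ← mvfderiv_comp_apply x ((hμ _ _).mdifferentiableAt (by simp)) hf,
      mvfderiv_congr e1, mvfderiv_congr e2]
    refine (mvfderiv_apply_frame_sub f μ (fun a => D'.eval (W a)) x (fun β => ?_)
      (fun l => c (i.succAbove l)) (fun l a => g (i.succAbove l) a ∘ f) (fun l a => hc _ _)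
      (fun l a => (hg _ _).comp x hf) (fun l a => hcg _ _) _).trans ?_
    · exact MDifferentiableAt.comp x ((hμ (fun l => W (β l)) (f x)).mdifferentiableAt (by simp)) hf
    · simp only [← hvc, Δ]
  rw [← sub_eq_zero]
  simp only [BracketData.extDeriv]
  rw [add_sub_add_comm, ← Finset.sum_sub_distrib]
  simp only [← mul_sub, hder]
  cases k with
  -- For functions there are no bracket terms, and the error sums are empty.
  | zero => simp [BracketData.bracketTerm]
  | succ k =>
    -- The anchor errors are already the first sum of the identity; it remains to match the bracket
    -- errors with the second sum, term by term.
    rw [← sum_update_add_sum_cons_eq_zero (μ (f x)) v Δ]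
    congr 1
    simp only [BracketData.bracketTerm, ← Finset.sum_sub_distrib]
    refine Finset.sum_congr rfl fun j _ => Finset.sum_congr rfl fun i _ => ?_
    split_ifs with h
    · rw [← mul_sub]
      congr 1
      have e3 : pullbackForm f Φ μ x
          (Fin.cons (D.eval (D.bracket (σ i.castSucc) (σ j)) x)
            (fun l : Fin k => D.eval (σ (j.succAbove (i.succAbove l))) x)) =
          μ (f x) (Fin.cons (Φ x (D.eval (D.bracket (σ i.castSucc) (σ j)) x))
            (fun l : Fin k => v (j.succAbove (i.succAbove l)))) := by
        simp only [pullbackForm, AlternatingMap.compLinearMap_apply]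
        congr 1
        ext m
        refine Fin.cases ?_ (fun m => ?_) m <;> rfl
      have hs : ∀ (a b : B (f x)) (w : Fin k → B (f x)), μ (f x) (Fin.cons a w) -
          μ (f x) (Fin.cons b w) = μ (f x) (Fin.cons (a - b) w) := fun a b w =>
        (congrArg (fun T => T w) ((μ (f x)).toMultilinearMap.curryLeft.map_sub a b)).symm
      simp only [hv]
      rw [e3, hs, hbr]
    · exact sub_self _

/-- Near each point the pulled-back form is a polynomial in smooth coefficients and the smooth
functions `μ (W β) ∘ f`. The family `W` is chosen before `σ`, since all `k` arguments are expanded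
in the same family. -/
theorem isSmoothForm_pullbackForm_of_frame (D : BracketData I A) (D' : BracketData J B)
    (f : M → N) (hf : ContMDiff I J ∞ f) (Φ : ∀ x, A x →ₗ[ℝ] B (f x))
    (hW : ∀ x, ∃ W : ι → D'.Sec, ∀ σ : D.Sec, ∃ c : ι → M → ℝ,
      (∀ a, ContMDiffAt I 𝓘(ℝ, ℝ) ∞ (c a) x) ∧
      ∀ᶠ y in 𝓝 x, Φ y (D.eval σ y) = ∑ a, c a y • D'.eval (W a) (f y))
    {k : ℕ} (μ : ∀ y, B y [⋀^Fin k]→ₗ[ℝ] ℝ) (hμ : D'.IsSmoothForm μ) :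
    D.IsSmoothForm (pullbackForm f Φ μ) := by
  intro σ x
  obtain ⟨W, hW⟩ := hW x
  choose c hc hσ using fun l => hW (σ l)
  have h : ContMDiffAt I 𝓘(ℝ, ℝ) ∞ (fun y => ∑ β : Fin k → ι, (∏ l, c l (β l) y) *
      μ (f y) (fun l => D'.eval (W (β l)) (f y))) x :=
    contMDiffAt_finsetSum fun β _ => (contMDiffAt_finsetProd fun l _ => hc l (β l)).mul
      (((hμ fun l => W (β l)).comp hf) x)
  refine h.congr_of_eventuallyEq ?_
  filter_upwards [eventually_all.2 hσ] with y hy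
  refine Eq.trans ?_
    (AlternatingMap.apply_sum_smul (μ (f y)) (fun l a => c l a y) (fun a => D'.eval (W a) (f y)))
  simp only [pullbackForm, AlternatingMap.compLinearMap_apply, hy]

end Morphism

/-! ### Local spanning sections of a prolongation -/

section ProlongationFrame

variable {EQ : Type*} [NormedAddCommGroup EQ] [NormedSpace ℝ EQ]
  {HQ : Type*} [TopologicalSpace HQ] {I : ModelWithCorners ℝ EQ HQ}
  {Q : Type*} [TopologicalSpace Q] [ChartedSpace HQ Q] [IsManifold I ∞ Q]
  {EP : Type*} [NormedAddCommGroup EP] [NormedSpace ℝ EP]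
  {HP : Type*} [TopologicalSpace HP] {IP : ModelWithCorners ℝ EP HP}
  {P : Type*} [TopologicalSpace P] [ChartedSpace HP P] [IsManifold IP ∞ P]

variable (I IP) in
/-- Over the neighbourhood `U` of `pr p₀`, in the charts at `p₀` and `pr p₀`, the map `pr` is the
linear projection `a`, which has the right inverse `r`. -/
structure IsLinearProjectionOver (pr : P → Q) (p₀ : P) (U : Set Q) (a : EP →L[ℝ] EQ)
    (r : EQ →L[ℝ] EP) : Prop where
  contMDiff_proj : ContMDiff IP I ∞ pr
  isOpen : IsOpen U
  mem : pr p₀ ∈ U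
  subset_source : U ⊆ (chartAt HQ (pr p₀)).source
  preimage_subset_source : pr ⁻¹' U ⊆ (chartAt HP p₀).source
  extChartAt_proj : ∀ p, pr p ∈ U → extChartAt I (pr p₀) (pr p) = a (extChartAt IP p₀ p)
  right_inv : ∀ u, a (r u) = u

namespace IsLinearProjectionOver

variable {pr : P → Q} {p₀ : P} {U : Set Q} {a : EP →L[ℝ] EQ} {r : EQ →L[ℝ] EP}

/-- The trivializations of the tangent bundles are the derivatives of the charts, so this is the
chain rule applied to the linear chart expression of `pr`. -/
theorem trivializationAt_mfderiv (h : IsLinearProjectionOver I IP pr p₀ U a r) {p : P}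
    (hp : pr p ∈ U) (v : TangentSpace IP p) :
    (trivializationAt EQ (TangentSpace I) (pr p₀)).continuousLinearMapAt ℝ (pr p)
        (mfderiv IP I pr p v) =
      a ((trivializationAt EP (TangentSpace IP) p₀).continuousLinearMapAt ℝ p v) := by
  rw [TangentBundle.continuousLinearMapAt_trivializationAt (h.subset_source hp),
    TangentBundle.continuousLinearMapAt_trivializationAt (h.preimage_subset_source hp)]
  have h1 : MDifferentiableAt IP I pr p := (h.contMDiff_proj p).mdifferentiableAt (by simp)
  have h2 := mdifferentiableAt_extChartAt (I := I) (h.subset_source hp)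
  have h3 := mdifferentiableAt_extChartAt (I := IP) (h.preimage_subset_source hp)
  have e : extChartAt I (pr p₀) ∘ pr =ᶠ[𝓝 p] a ∘ extChartAt IP p₀ := by
    filter_upwards [(h.isOpen.preimage h.contMDiff_proj.continuous).mem_nhds hp] with p' hp'
    exact h.extChartAt_proj p' hp'
  have h4 : MDifferentiableAt 𝓘(ℝ, EP) 𝓘(ℝ, EQ) a (extChartAt IP p₀ p) :=
    a.differentiableAt.mdifferentiableAt
  have e2 := congrArg (fun T => T v) (mfderiv_comp p h2 h1)
  have e3 := congrArg (fun T => T v) (mfderiv_comp p h4 h3)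
  rw [mfderiv_eq_fderiv, a.fderiv] at e3
  refine e2.symm.trans (Eq.trans ?_ e3)
  rw [e.mfderiv_eq]
  rfl

variable {F : Type*} [NormedAddCommGroup F] [NormedSpace ℝ F]
  {E : Q → Type*} [∀ q, AddCommGroup (E q)] [∀ q, Module ℝ (E q)]
  [TopologicalSpace (TotalSpace F E)] [∀ q, TopologicalSpace (E q)]
  [FiberBundle F E] [VectorBundle ℝ F E] {𝓔 : LieAlgebroid I F E}
  [FiniteDimensional ℝ EQ] [T2Space Q] [FiniteDimensional ℝ F] [ContMDiffVectorBundle ∞ F E I]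

/-- The coordinates of the tangent vector over `ρ(σ)` with vertical part `k`. -/
def liftCoord (𝓔 : LieAlgebroid I F E) (pr : P → Q) (p₀ : P) (a : EP →L[ℝ] EQ) (r : EQ →L[ℝ] EP)
    (σ : Cₛ^∞⟮I; F, E⟯) (k : EP) (p : P) : EP :=
  r ((trivializationAt EQ (TangentSpace I) (pr p₀)).continuousLinearMapAt ℝ (pr p)
    (𝓔.anchor (pr p) (σ (pr p)))) + (k - r (a k))

theorem contMDiffOn_liftCoord (h : IsLinearProjectionOver I IP pr p₀ U a r)
    (σ : Cₛ^∞⟮I; F, E⟯) (k : EP) :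
    ContMDiffOn IP 𝓘(ℝ, EP) ∞ (liftCoord 𝓔 pr p₀ a r σ k) (pr ⁻¹' U) := by
  have hb : MapsTo (fun q => (⟨q, 𝓔.anchor q (σ q)⟩ : TangentBundle I Q)) U
      (trivializationAt EQ (TangentSpace I) (pr p₀)).source := by
    intro q hq
    rw [Trivialization.mem_source, TangentBundle.trivializationAt_baseSet]
    exact h.subset_source hq
  have h1 : ContMDiffOn I 𝓘(ℝ, EQ) ∞ (fun q =>
      (trivializationAt EQ (TangentSpace I) (pr p₀)).continuousLinearMapAt ℝ q
        (𝓔.anchor q (σ q))) U := by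
    refine (((trivializationAt EQ (TangentSpace I) (pr p₀)).contMDiffOn_iff hb).1
      (𝓔.contMDiff_anchor_section σ).contMDiffOn).2.congr fun q hq => ?_
    rw [Trivialization.continuousLinearMapAt_apply_of_mem]
    rw [TangentBundle.trivializationAt_baseSet]
    exact h.subset_source hq
  have h2 := h1.comp h.contMDiff_proj.contMDiffOn (fun p hp => hp)
  exact (r.contMDiff.comp_contMDiffOn h2).add contMDiffOn_const

/-- The section of the prolongation with `E`-component `ψ σ` and vertical part `ψ k`. -/
def liftSection (h : IsLinearProjectionOver I IP pr p₀ U a r) (ψ : SmoothBumpFunction I (pr p₀))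
    (hψ : tsupport ψ ⊆ U) (σ : Cₛ^∞⟮I; F, E⟯) (k : EP) : 𝓔.ProlongationSection IP pr where
  fst p := ψ (pr p) • σ (pr p)
  vec p := ψ (pr p) • (trivializationAt EP (TangentSpace IP) p₀).symmL ℝ p
    (liftCoord 𝓔 pr p₀ a r σ k p)
  contMDiff_fst := (ψ.contMDiff.smul_section σ.contMDiff).comp h.contMDiff_proj
  contMDiff_vec := by
    have ho : IsOpen (pr ⁻¹' U) := h.isOpen.preimage h.contMDiff_proj.continuous
    -- The local lift is smooth only over `U`; the cutoff `ψ ∘ pr` is supported over `U` and extends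
    -- it by zero.
    refine ContMDiffOn.smul_section_of_tsupport (u := pr ⁻¹' U) (ψ := ψ ∘ pr)
      (ψ.contMDiff.comp h.contMDiff_proj).contMDiffOn ho ?_ ?_
    · refine (closure_minimal (fun p hp => ?_)
        ((isClosed_tsupport ψ).preimage h.contMDiff_proj.continuous)).trans (preimage_mono hψ)
      exact subset_tsupport _ hp
    · have hb : ∀ p ∈ pr ⁻¹' U, p ∈ (trivializationAt EP (TangentSpace IP) p₀).baseSet := by
        intro p hp
        rw [TangentBundle.trivializationAt_baseSet]
        exact h.preimage_subset_source hp
      refine ((trivializationAt EP (TangentSpace IP) p₀).contMDiffOn_iff (fun p hp => ?_)).2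
        ⟨contMDiffOn_id, (h.contMDiffOn_liftCoord (𝓔 := 𝓔) σ k).congr fun p hp => ?_⟩
      · rw [Trivialization.mem_source]
        exact hb p hp
      · have := (trivializationAt EP (TangentSpace IP) p₀).continuousLinearMapAt_symmL (R := ℝ)
          (hb p hp) (liftCoord 𝓔 pr p₀ a r σ k p)
        rw [Trivialization.continuousLinearMapAt_apply_of_mem ℝ _ (hb p hp)] at this
        exact this
  anchor_fst p := by
    rw [map_smul, map_smul]
    by_cases hp : pr p ∈ U
    · congr 1
      have hb : pr p ∈ (trivializationAt EQ (TangentSpace I) (pr p₀)).baseSet := by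
        rw [TangentBundle.trivializationAt_baseSet]
        exact h.subset_source hp
      have hb' : p ∈ (trivializationAt EP (TangentSpace IP) p₀).baseSet := by
        rw [TangentBundle.trivializationAt_baseSet]
        exact h.preimage_subset_source hp
      rw [← (trivializationAt EQ (TangentSpace I) (pr p₀)).symmL_continuousLinearMapAt (R := ℝ) hb
          (mfderiv IP I pr p _),
        h.trivializationAt_mfderiv hp, Trivialization.continuousLinearMapAt_symmL _ hb']
      -- As `a ∘ r = id`, the map `a` kills `k - r (a k)` and returns the coordinates of the anchor
      -- from the first summand.
      simp only [liftCoord, map_add, map_sub, h.right_inv, sub_self, add_zero]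
      rw [Trivialization.symmL_continuousLinearMapAt _ hb]
    · rw [image_eq_zero_of_notMem_tsupport (fun hh => hp (hψ hh)), zero_smul, zero_smul]

variable [FiniteDimensional ℝ EP]

/-- Sections that span the prolongation near `p₀`. -/
def frameSection (h : IsLinearProjectionOver I IP pr p₀ U a r) (ψ : SmoothBumpFunction I (pr p₀))
    (hψ : tsupport ψ ⊆ U) :
    Fin (finrank ℝ F) ⊕ Fin (finrank ℝ EP) → 𝓔.ProlongationSection IP pr
  | Sum.inl i => h.liftSection ψ hψ (frame I F E (pr p₀) i) 0
  | Sum.inr j => h.liftSection ψ hψ 0 (finBasis ℝ EP j)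

variable (𝓔 IP pr) in
/-- Coefficients of the elements of the prolongation with respect to `frameSection`. -/
def frameCoeff (p₀ : P) (b : Fin (finrank ℝ F) ⊕ Fin (finrank ℝ EP)) (p : P)
    (w : 𝓔.prolongation IP pr p) : ℝ :=
  match b with
  | Sum.inl i => coframe I F E (pr p₀) i ⟨pr p, w.1.1⟩
  | Sum.inr j => (finBasis ℝ EP).repr
      (trivializationAt EP (TangentSpace IP) p₀ ⟨p, w.1.2⟩).2 j

/-- Let `u` be the coordinates of the tangent component. The lifts of the frame of E contribute `r
(a u)`, because `a u` represents both the projected tangent vector and the anchor. The vertical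
sections contribute `u - r (a u)`. Taking all coordinates of `u` as coefficients avoids choosing a
basis of `ker a`, at the price of a redundant family. -/
theorem sum_frameCoeff_smul_frameSection (h : IsLinearProjectionOver I IP pr p₀ U a r)
    (ψ : SmoothBumpFunction I (pr p₀)) (hψ : tsupport ψ ⊆ U) (p : P) (hp : pr p ∈ U)
    (hψp : ψ (pr p) = 1) (hbp : bump I F E (pr p₀) (pr p) = 1) (w : 𝓔.prolongation IP pr p) :
    w = ∑ b, frameCoeff IP pr 𝓔 p₀ b p w • (h.frameSection ψ hψ b).eval p := by
  obtain ⟨⟨x, v⟩, hw⟩ := w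
  have hw' : 𝓔.anchor (pr p) x = mfderiv IP I pr p v := hw
  have hb' : p ∈ (trivializationAt EP (TangentSpace IP) p₀).baseSet := by
    rw [TangentBundle.trivializationAt_baseSet]
    exact h.preimage_subset_source hp
  let u : EP := (trivializationAt EP (TangentSpace IP) p₀).continuousLinearMapAt ℝ p v
  have hu : (trivializationAt EP (TangentSpace IP) p₀ ⟨p, v⟩).2 = u := by
    simp only [u]
    rw [Trivialization.continuousLinearMapAt_apply_of_mem ℝ _ hb']
  have hx := sum_coframe_smul_frame (I := I) (F := F) (E := E) (pr p₀) (pr p) hbp x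
  rw [Fintype.sum_sum_type]
  apply Subtype.ext
  simp only [Submodule.coe_add, Submodule.coe_sum, Submodule.coe_smul]
  refine Prod.ext ?_ ?_
  · simp only [Prod.fst_add, Prod.fst_sum, Prod.smul_fst]
    have e1 : ∀ j, ((h.frameSection (𝓔 := 𝓔) ψ hψ (Sum.inr j)).eval p).1.1 = 0 := by
      intro j
      exact smul_zero _
    have e2 : ∀ i, ((h.frameSection (𝓔 := 𝓔) ψ hψ (Sum.inl i)).eval p).1.1 =
        frame I F E (pr p₀) i (pr p) := by
      intro i
      change ψ (pr p) • _ = _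
      rw [hψp, one_smul]
    simp only [e1, e2, smul_zero, Finset.sum_const_zero, add_zero]
    exact hx.symm
  · simp only [Prod.snd_add, Prod.snd_sum, Prod.smul_snd]
    have e : ∀ b, ((h.frameSection (𝓔 := 𝓔) ψ hψ b).eval p).1.2 =
        (trivializationAt EP (TangentSpace IP) p₀).symmL ℝ p (match b with
          | Sum.inl i => r ((trivializationAt EQ (TangentSpace I) (pr p₀)).continuousLinearMapAt ℝ
              (pr p) (𝓔.anchor (pr p) (frame I F E (pr p₀) i (pr p))))
          | Sum.inr j => finBasis ℝ EP j - r (a (finBasis ℝ EP j))) := by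
      rintro (i | j)
      · change ψ (pr p) • _ = _
        rw [hψp, one_smul]
        congr 1
        simp [liftCoord]
      · change ψ (pr p) • _ = _
        rw [hψp, one_smul]
        congr 1
        have : (0 : Cₛ^∞⟮I; F, E⟯) (pr p) = 0 := rfl
        simp [liftCoord, this]
    simp only [e, frameCoeff, hu, ← map_smul, ← map_sum, ← map_add]
    rw [hx, hw', h.trivializationAt_mfderiv hp]
    -- This is the linear map `id - r ∘ a` applied to the basis expansion of `u`.
    have e3 : ∑ j, (finBasis ℝ EP).repr u j • (finBasis ℝ EP j - r (a (finBasis ℝ EP j))) =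
        u - r (a u) := by
      conv_rhs => rw [← (finBasis ℝ EP).sum_repr u]
      simp only [smul_sub, Finset.sum_sub_distrib, map_sum, map_smul]
    rw [e3]
    have e4 : r (a u) + (u - r (a u)) = u := by abel
    refine Eq.trans ?_ (congrArg _ e4.symm)
    exact ((trivializationAt EP (TangentSpace IP) p₀).symmL_continuousLinearMapAt (R := ℝ) hb' v).symm

/-- Stated along a map `f` to cover two uses: `f = γ` for lifted sections of E, and `f = id` for
sections of the prolongation. -/
theorem contMDiffAt_frameCoeff {EM : Type*} [NormedAddCommGroup EM] [NormedSpace ℝ EM]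
    {HM : Type*} [TopologicalSpace HM] {IM : ModelWithCorners ℝ EM HM}
    {M : Type*} [TopologicalSpace M] [ChartedSpace HM M] (f : M → P) (x : M)
    (w : ∀ y, 𝓔.prolongation IP pr (f y))
    (h₁ : ContMDiffAt IM (I.prod 𝓘(ℝ, F)) ∞
      (fun y => (⟨pr (f y), (w y).1.1⟩ : TotalSpace F E)) x)
    (h₂ : ContMDiffAt IM IP.tangent ∞ (fun y => (⟨f y, (w y).1.2⟩ : TangentBundle IP P)) x)
    (b : Fin (finrank ℝ F) ⊕ Fin (finrank ℝ EP)) :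
    ContMDiffAt IM 𝓘(ℝ, ℝ) ∞ (fun y => frameCoeff IP pr 𝓔 (f x) b (f y) (w y)) x := by
  cases b with
  | inl i => exact (contMDiff_coframe I F E (pr (f x)) i).contMDiffAt.comp x h₁
  | inr j =>
    have h := (contMDiffAt_totalSpace.1 h₂).2
    exact (LinearMap.toContinuousLinearMap ((finBasis ℝ EP).coord j)).contMDiff.contMDiffAt.comp x h

end IsLinearProjectionOver

end ProlongationFrame

/-! ### Commutators of vector fields that are related at one point -/

section Calculus

variable {EM : Type*} [NormedAddCommGroup EM] [NormedSpace ℝ EM]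
  {HM : Type*} [TopologicalSpace HM] {I : ModelWithCorners ℝ EM HM}
  {M : Type*} [TopologicalSpace M] [ChartedSpace HM M] [IsManifold I ∞ M]
  {ι : Type*} [Fintype ι]

theorem mvfderiv_sum_mul (c m : ι → M → ℝ) (x : M)
    (hc : ∀ a, MDifferentiableAt I 𝓘(ℝ, ℝ) (c a) x) (hm : ∀ a, MDifferentiableAt I 𝓘(ℝ, ℝ) (m a) x)
    (v : TangentSpace I x) :
    mvfderiv I (fun y => ∑ a, c a y * m a y) x v =
      ∑ a, (mvfderiv I (c a) x v * m a x + c a x * mvfderiv I (m a) x v) := by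
  rw [mvfderiv_finset_sum _ (fun a y => c a y * m a y) _ fun a => (hc a).mul (hm a),
    _root_.sum_apply]
  refine Finset.sum_congr rfl fun a _ => ?_
  have h := congrArg (fun T => T v) (mvfderiv_mul (hc a) (hm a))
  refine h.trans ?_
  simp only [_root_.add_apply, _root_.smul_apply, smul_eq_mul]
  ring

/-- The terms that differentiate `m` cancel because the coefficients agree at `x`. -/
theorem mvfderiv_sum_mul_sub (c c' m : ι → M → ℝ) (x : M)
    (hc : ∀ a, MDifferentiableAt I 𝓘(ℝ, ℝ) (c a) x)
    (hc' : ∀ a, MDifferentiableAt I 𝓘(ℝ, ℝ) (c' a) x)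
    (hm : ∀ a, MDifferentiableAt I 𝓘(ℝ, ℝ) (m a) x) (hcc : ∀ a, c a x = c' a x)
    (v : TangentSpace I x) :
    mvfderiv I (fun y => ∑ a, c a y * m a y) x v - mvfderiv I (fun y => ∑ a, c' a y * m a y) x v =
      ∑ a, (mvfderiv I (c a) x v - mvfderiv I (c' a) x v) * m a x := by
  rw [mvfderiv_sum_mul c m x hc hm, mvfderiv_sum_mul c' m x hc' hm, ← Finset.sum_sub_distrib]
  refine Finset.sum_congr rfl fun a _ => ?_
  rw [hcc]
  ring

variable {EN : Type*} [NormedAddCommGroup EN] [NormedSpace ℝ EN]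
  {HN : Type*} [TopologicalSpace HN] {J : ModelWithCorners ℝ EN HN}
  {N : Type*} [TopologicalSpace N] [ChartedSpace HN N] [IsManifold J ∞ N]

/-- Vectors `U`, `U'` that act on functions as the commutators of the vector fields `V i` on `M`
and `X i` on `N`: the difference of `Tf(U)` and `U'` if `V i` and `X i` are `f`-related at `x`. -/
theorem mfderiv_commutator_sub [FiniteDimensional ℝ EN] [T2Space N] [J.Boundaryless]
    (f : M → N) (hf : ContMDiff I J ∞ f) (x : M)
    (V₁ V₂ : ∀ y, TangentSpace I y) (X₁ X₂ : ∀ z, TangentSpace J z)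
    (hX₁ : ContMDiff J J.tangent ∞ (fun z => (⟨z, X₁ z⟩ : TangentBundle J N)))
    (hX₂ : ContMDiff J J.tangent ∞ (fun z => (⟨z, X₂ z⟩ : TangentBundle J N)))
    (W : ι → ∀ z, TangentSpace J z)
    (hW : ∀ b, ContMDiff J J.tangent ∞ (fun z => (⟨z, W b z⟩ : TangentBundle J N)))
    (c₁ c₂ : ι → M → ℝ) (g₁ g₂ : ι → N → ℝ)
    (hc₁ : ∀ b, MDifferentiableAt I 𝓘(ℝ, ℝ) (c₁ b) x)
    (hc₂ : ∀ b, MDifferentiableAt I 𝓘(ℝ, ℝ) (c₂ b) x)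
    (hg₁ : ∀ b, MDifferentiableAt J 𝓘(ℝ, ℝ) (g₁ b) (f x))
    (hg₂ : ∀ b, MDifferentiableAt J 𝓘(ℝ, ℝ) (g₂ b) (f x))
    (hcg₁ : ∀ b, c₁ b x = g₁ b (f x)) (hcg₂ : ∀ b, c₂ b x = g₂ b (f x))
    (hV₁ : ∀ᶠ y in 𝓝 x, mfderiv I J f y (V₁ y) = ∑ b, c₁ b y • W b (f y))
    (hV₂ : ∀ᶠ y in 𝓝 x, mfderiv I J f y (V₂ y) = ∑ b, c₂ b y • W b (f y))
    (hXW₁ : ∀ᶠ z in 𝓝 (f x), X₁ z = ∑ b, g₁ b z • W b z)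
    (hXW₂ : ∀ᶠ z in 𝓝 (f x), X₂ z = ∑ b, g₂ b z • W b z)
    (hVX₁ : X₁ (f x) = mfderiv I J f x (V₁ x)) (hVX₂ : X₂ (f x) = mfderiv I J f x (V₂ x))
    (U : TangentSpace I x)
    (hU : ∀ h : M → ℝ, ContMDiff I 𝓘(ℝ, ℝ) ∞ h → mvfderiv I h x U =
      mvfderiv I (fun y => mvfderiv I h y (V₂ y)) x (V₁ x) -
      mvfderiv I (fun y => mvfderiv I h y (V₁ y)) x (V₂ x)) :
    mfderiv I J f x U - mlieBracket J X₁ X₂ (f x) =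
      (∑ b, (mvfderiv I (c₂ b) x (V₁ x) - mvfderiv I (g₂ b ∘ f) x (V₁ x)) • W b (f x)) -
      ∑ b, (mvfderiv I (c₁ b) x (V₂ x) - mvfderiv I (g₁ b ∘ f) x (V₂ x)) • W b (f x) := by
  have := FiniteDimensional.complete ℝ EN
  apply tangent_ext
  intro h hh
  have hd : ∀ {k : N → ℝ}, ContMDiff J 𝓘(ℝ, ℝ) ∞ k → ∀ z, MDifferentiableAt J 𝓘(ℝ, ℝ) k z :=
    fun hk z => (hk z).mdifferentiableAt (by simp)
  have hdf : ∀ y, MDifferentiableAt I J f y := fun y => (hf y).mdifferentiableAt (by simp)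
  -- One half of the commutator, tested on `h`. Near `x`, both `V (h ∘ f)` and `(X h) ∘ f` are
  -- combinations of the same functions `(W b h) ∘ f`, with coefficients that agree at `x`.
  have key : ∀ (V V' : ∀ y, TangentSpace I y) (X X' : ∀ z, TangentSpace J z)
      (c : ι → M → ℝ) (g : ι → N → ℝ),
      (ContMDiff J J.tangent ∞ (fun z => (⟨z, X z⟩ : TangentBundle J N))) →
      (∀ b, MDifferentiableAt I 𝓘(ℝ, ℝ) (c b) x) →
      (∀ b, MDifferentiableAt J 𝓘(ℝ, ℝ) (g b) (f x)) → (∀ b, c b x = g b (f x)) →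
      (∀ᶠ y in 𝓝 x, mfderiv I J f y (V y) = ∑ b, c b y • W b (f y)) →
      (∀ᶠ z in 𝓝 (f x), X z = ∑ b, g b z • W b z) → X' (f x) = mfderiv I J f x (V' x) →
      mvfderiv I (fun y => mvfderiv I (h ∘ f) y (V y)) x (V' x) -
        mvfderiv J (fun z => mvfderiv J h z (X z)) (f x) (X' (f x)) =
      ∑ b, (mvfderiv I (c b) x (V' x) - mvfderiv I (g b ∘ f) x (V' x)) *
        mvfderiv J h (f x) (W b (f x)) := by
    intro V V' X X' c g hX hc hg hcg hV hXW hVX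
    have e1 : (fun y => mvfderiv I (h ∘ f) y (V y)) =ᶠ[𝓝 x]
        fun y => ∑ b, c b y * mvfderiv J h (f y) (W b (f y)) := by
      filter_upwards [hV] with y hy
      rw [mvfderiv_comp_apply y (hd hh _) (hdf y), hy]
      simp only [map_sum, map_smul, smul_eq_mul]
    have e2 : (fun z => mvfderiv J h z (X z)) ∘ f =ᶠ[𝓝 x]
        fun y => ∑ b, (g b ∘ f) y * mvfderiv J h (f y) (W b (f y)) := by
      filter_upwards [hf.continuous.continuousAt.eventually hXW] with y hy
      simp only [Function.comp_apply, hy, map_sum, map_smul, smul_eq_mul]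
    rw [hVX, ← mvfderiv_comp_apply x (hd (contMDiff_mvfderiv_apply h hh X hX) _) (hdf x),
      mvfderiv_congr e1, mvfderiv_congr e2]
    exact mvfderiv_sum_mul_sub c (fun b => g b ∘ f)
      (fun b y => mvfderiv J h (f y) (W b (f y))) x hc (fun b => (hg b).comp x (hdf x))
      (fun b => MDifferentiableAt.comp x (hd (contMDiff_mvfderiv_apply h hh _ (hW b)) _) (hdf x))
      hcg _
  have k1 := key V₂ V₁ X₂ X₁ c₂ g₂ hX₂ hc₂ hg₂ hcg₂ hV₂ hXW₂ hVX₁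
  have k2 := key V₁ V₂ X₁ X₂ c₁ g₁ hX₁ hc₁ hg₁ hcg₁ hV₁ hXW₁ hVX₂
  have hb := mvfderiv_mlieBracket (f x) h hh X₁ X₂ hX₁ hX₂
    (hd (contMDiff_mvfderiv_apply h hh X₁ hX₁) _) (hd (contMDiff_mvfderiv_apply h hh X₂ hX₂) _)
  -- `Tf(U)` acts on `h` as `U` acts on `h ∘ f`, which turns the assumption on `U` into the
  -- commutator that `k1` and `k2` compare.
  have hu := hU (h ∘ f) (hh.comp hf)
  rw [mvfderiv_comp_apply x (hd hh _) (hdf x)] at hu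
  simp only [map_sub, map_sum, map_smul, smul_eq_mul]
  rw [hb, hu, ← k1, ← k2]
  ring

end Calculus

/-! ### Brackets of sections of E in a local frame -/

namespace LieAlgebroid

variable {EQ : Type*} [NormedAddCommGroup EQ] [NormedSpace ℝ EQ]
  {HQ : Type*} [TopologicalSpace HQ] {I : ModelWithCorners ℝ EQ HQ}
  {Q : Type*} [TopologicalSpace Q] [ChartedSpace HQ Q] [IsManifold I ∞ Q]
  {F : Type*} [NormedAddCommGroup F] [NormedSpace ℝ F]
  {E : Q → Type*} [∀ q, AddCommGroup (E q)] [∀ q, Module ℝ (E q)]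
  [TopologicalSpace (TotalSpace F E)] [∀ q, TopologicalSpace (E q)]
  [FiberBundle F E] [VectorBundle ℝ F E]
  [FiniteDimensional ℝ EQ] [T2Space Q] [FiniteDimensional ℝ F] [ContMDiffVectorBundle ∞ F E I]
  (𝓔 : LieAlgebroid I F E)

/-- The coefficients of a section of `E` in the frame near `q₀`. -/
def sectionCoeff (q₀ : Q) (σ : Cₛ^∞⟮I; F, E⟯) (i : Fin (finrank ℝ F)) : C^∞⟮I, Q; ℝ⟯ :=
  ⟨fun q => coframe I F E q₀ i ⟨q, σ q⟩, (contMDiff_coframe I F E q₀ i).comp σ.contMDiff⟩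

/-- By locality of the bracket, `τ` may be replaced by its global expansion in the cut-off frame;
then the Leibniz rule applies. -/
theorem bracket_eq_sum_right (σ τ : Cₛ^∞⟮I; F, E⟯) (q₀ q : Q)
    (hq : ∀ᶠ q' in 𝓝 q, bump I F E q₀ q' = 1) :
    𝓔.bracket σ τ q = ∑ j, (sectionCoeff q₀ τ j q • 𝓔.bracket σ (frame I F E q₀ j) q +
      𝓔.anchorDeriv σ (sectionCoeff q₀ τ j) q • frame I F E q₀ j q) := by
  rw [𝓔.bracket_congr_right σ τ (∑ j, smulSection (sectionCoeff q₀ τ j) (frame I F E q₀ j)) q,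
    𝓔.bracket_sum_right, sum_section_apply]
  · refine Finset.sum_congr rfl fun j _ => ?_
    rw [𝓔.leibniz']
    rfl
  · filter_upwards [hq] with q' hq'
    rw [sum_section_apply]
    exact (sum_coframe_smul_frame q₀ q' hq' (τ q')).symm

/-- The bracket of two sections of `E` in a local frame. -/
theorem bracket_eq_sum (σ τ : Cₛ^∞⟮I; F, E⟯) (q₀ q : Q)
    (hq : ∀ᶠ q' in 𝓝 q, bump I F E q₀ q' = 1) :
    𝓔.bracket σ τ q =
      (∑ i, ∑ j, (sectionCoeff q₀ σ i q * sectionCoeff q₀ τ j q) •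
        𝓔.bracket (frame I F E q₀ i) (frame I F E q₀ j) q) +
      (∑ j, 𝓔.anchorDeriv σ (sectionCoeff q₀ τ j) q • frame I F E q₀ j q) -
      ∑ i, 𝓔.anchorDeriv τ (sectionCoeff q₀ σ i) q • frame I F E q₀ i q := by
  -- Expanding the left argument leaves derivatives along the frame sections, weighted by the
  -- coefficients of `τ`; these recombine into derivatives along `τ`.
  have hτ : ∀ f : C^∞⟮I, Q; ℝ⟯, 𝓔.anchorDeriv τ f q =
      ∑ j, sectionCoeff q₀ τ j q * 𝓔.anchorDeriv (frame I F E q₀ j) f q := by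
    intro f
    change mvfderiv I f q (𝓔.anchor q (τ q)) = _
    conv_lhs => rw [← sum_coframe_smul_frame q₀ q hq.self_of_nhds (τ q)]
    simp only [map_sum, map_smul, smul_eq_mul]
    rfl
  have hσ : ∀ j, 𝓔.bracket σ (frame I F E q₀ j) q =
      ∑ i, (sectionCoeff q₀ σ i q • 𝓔.bracket (frame I F E q₀ i) (frame I F E q₀ j) q -
        𝓔.anchorDeriv (frame I F E q₀ j) (sectionCoeff q₀ σ i) q • frame I F E q₀ i q) := by
    intro j
    rw [𝓔.bracket_skew, ContMDiffSection.coe_neg, Pi.neg_apply, 𝓔.bracket_eq_sum_right _ σ q₀ q hq,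
      ← Finset.sum_neg_distrib]
    refine Finset.sum_congr rfl fun i _ => ?_
    rw [𝓔.bracket_skew (frame I F E q₀ j), ContMDiffSection.coe_neg, Pi.neg_apply]
    module
  rw [𝓔.bracket_eq_sum_right σ τ q₀ q hq]
  simp only [hσ, hτ, Finset.sum_add_distrib, Finset.smul_sum, smul_sub, Finset.sum_sub_distrib,
    Finset.sum_smul, smul_smul]
  rw [Finset.sum_comm (f := fun j i => (sectionCoeff q₀ τ j q * sectionCoeff q₀ σ i q) • _),
    Finset.sum_comm (f := fun j i => (sectionCoeff q₀ τ j q * 𝓔.anchorDeriv _ _ q) • _)]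
  simp only [mul_comm (sectionCoeff q₀ σ _ q)]
  abel

end LieAlgebroid

/-- Points over different base points are separated in the base, points of one fibre inside a
trivialization. The Hausdorff property of E* × ℝ is what lets smooth functions separate its tangent
vectors. -/
theorem FiberBundle.t2Space_totalSpace {B : Type*} (F : Type*) (E : B → Type*)
    [TopologicalSpace B] [TopologicalSpace F] [TopologicalSpace (TotalSpace F E)]
    [∀ b, TopologicalSpace (E b)] [FiberBundle F E] [T2Space B] [T2Space F] :
    T2Space (TotalSpace F E) := by
  refine ⟨fun x y hxy => ?_⟩
  by_cases h : x.proj = y.proj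
  · let e := trivializationAt F E x.proj
    have hx : x ∈ e.source := FiberBundle.mem_trivializationAt_proj_source
    have hy : y ∈ e.source := by
      rw [e.mem_source, ← h]
      exact FiberBundle.mem_baseSet_trivializationAt F E x.proj
    obtain ⟨u, v, hu, hv, hxu, hyv, huv⟩ := t2_separation (e.injOn.ne hx hy hxy)
    refine ⟨e.source ∩ e ⁻¹' u, e.source ∩ e ⁻¹' v, e.continuousOn.isOpen_inter_preimage e.open_source hu,
      e.continuousOn.isOpen_inter_preimage e.open_source hv, ⟨hx, hxu⟩, ⟨hy, hyv⟩, ?_⟩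
    exact (huv.preimage e).mono inter_subset_right inter_subset_right
  · obtain ⟨u, v, hu, hv, hxu, hyv, huv⟩ := t2_separation h
    exact ⟨_, _, hu.preimage (FiberBundle.continuous_proj F E),
      hv.preimage (FiberBundle.continuous_proj F E), hxu, hyv, huv.preimage _⟩

/-! ### The lift to the prolongation over E* × ℝ -/

section Contact

variable {EQ : Type*} [NormedAddCommGroup EQ] [NormedSpace ℝ EQ]
  {HQ : Type*} [TopologicalSpace HQ] {I : ModelWithCorners ℝ EQ HQ}
  {Q : Type*} [TopologicalSpace Q] [ChartedSpace HQ Q] [IsManifold I ∞ Q]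
  {F : Type*} [NormedAddCommGroup F] [NormedSpace ℝ F]
  {E : Q → Type*} [∀ q, AddCommGroup (E q)] [∀ q, Module ℝ (E q)]
  [TopologicalSpace (TotalSpace F E)] [∀ q, TopologicalSpace (E q)]
  [∀ q, IsTopologicalAddGroup (E q)] [∀ q, ContinuousSMul ℝ (E q)]
  [FiberBundle F E] [VectorBundle ℝ F E] [ContMDiffVectorBundle ∞ F E I]

/-- In the charts of `E* × ℝ`, the projection to `Q` is linear. -/
theorem isLinearProjectionOver_dualProj (p₀ : DualR F E) :
    IsLinearProjectionOver I (dualModel I F) (dualProj : DualR F E → Q) p₀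
      ((trivializationAt (F →L[ℝ] ℝ) (DualFiber E) (dualProj p₀)).baseSet ∩
        (chartAt HQ (dualProj p₀)).source)
      (ContinuousLinearMap.fst ℝ EQ (F →L[ℝ] ℝ) ∘L ContinuousLinearMap.fst ℝ _ ℝ)
      (ContinuousLinearMap.inl ℝ _ ℝ ∘L ContinuousLinearMap.inl ℝ EQ (F →L[ℝ] ℝ)) where
  contMDiff_proj := contMDiff_dualProj I F E
  isOpen := (Trivialization.open_baseSet _).inter (OpenPartialHomeomorph.open_source _)
  mem := ⟨FiberBundle.mem_baseSet_trivializationAt _ _ _, mem_chart_source _ _⟩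
  subset_source := inter_subset_right
  preimage_subset_source := by
    intro p hp
    rw [prodChartedSpace_chartAt, FiberBundle.chartedSpace_chartAt]
    have h1 : p.1 ∈ (trivializationAt (F →L[ℝ] ℝ) (DualFiber E) p₀.1.proj).source :=
      (Trivialization.mem_source _).2 hp.1
    have h2 := (trivializationAt (F →L[ℝ] ℝ) (DualFiber E) p₀.1.proj).coe_fst h1
    refine ⟨⟨h1, ?_, trivial⟩, trivial⟩
    change (trivializationAt (F →L[ℝ] ℝ) (DualFiber E) p₀.1.proj p.1).1 ∈
      (chartAt HQ p₀.1.proj).source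
    rw [h2]
    exact hp.2
  extChartAt_proj := by
    intro p hp
    have h1 : p.1 ∈ (trivializationAt (F →L[ℝ] ℝ) (DualFiber E) p₀.1.proj).source :=
      (Trivialization.mem_source _).2 hp.1
    have h2 := (trivializationAt (F →L[ℝ] ℝ) (DualFiber E) p₀.1.proj).coe_fst h1
    rw [extChartAt_prod, FiberBundle.extChartAt]
    change _ = extChartAt I p₀.1.proj (trivializationAt (F →L[ℝ] ℝ) (DualFiber E) p₀.1.proj p.1).1
    rw [h2]
    rfl
  right_inv _ := rfl

namespace LieAlgebroid

variable [FiniteDimensional ℝ EQ] [T2Space Q] [FiniteDimensional ℝ F] [I.Boundaryless]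
  (𝓔 : LieAlgebroid I F E)
  (γ₀ : Cₛ^∞⟮I; F →L[ℝ] ℝ, DualFiber E⟯) (γs : C^∞⟮I, Q; ℝ⟯)
  {ι : Type*} [Fintype ι]

theorem mdifferentiableAt_dualSection (q : Q) :
    MDifferentiableAt I (dualModel I F) (dualSection γ₀ γs) q :=
  (contMDiff_dualSection γ₀ γs q).mdifferentiableAt (by simp)

/-- The difference of the derivatives of the coefficients of a section `σ` of `E` and of a section
`Z` of the prolongation that agree at `x` via `liftMap`. -/
theorem anchorDeriv_sectionCoeff_sub (x : Q) (W : ι → 𝓔.ProlongationSection (dualModel I F) dualProj)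
    (σ τ : Cₛ^∞⟮I; F, E⟯) (Z : 𝓔.ProlongationSection (dualModel I F) dualProj)
    (c : ι → Q → ℝ) (g : ι → DualR F E → ℝ)
    (hc : ∀ b, MDifferentiableAt I 𝓘(ℝ, ℝ) (c b) x)
    (hg : ∀ b, MDifferentiableAt (dualModel I F) 𝓘(ℝ, ℝ) (g b) (dualSection γ₀ γs x))
    (hcg : ∀ b, c b x = g b (dualSection γ₀ γs x))
    (hσ : ∀ᶠ y in 𝓝 x, 𝓔.liftMap γ₀ γs y (σ y) =
      ∑ b, c b y • (W b).eval (dualSection γ₀ γs y))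
    (hZ : ∀ᶠ z in 𝓝 (dualSection γ₀ γs x), Z.eval z = ∑ b, g b z • (W b).eval z)
    (j : Fin (finrank ℝ F)) :
    𝓔.anchorDeriv τ (sectionCoeff x σ j) x - mvfderiv (dualModel I F) (Z.coeff x j)
        (dualSection γ₀ γs x)
        (mfderiv I (dualModel I F) (dualSection γ₀ γs) x (𝓔.anchor x (τ x))) =
      ∑ b, (mvfderiv I (c b) x (𝓔.anchor x (τ x)) -
        mvfderiv I (g b ∘ dualSection γ₀ γs) x (𝓔.anchor x (τ x))) *
          (W b).coeff x j (dualSection γ₀ γs x) := by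
  have hγ := mdifferentiableAt_dualSection γ₀ γs x
  have hbump : ∀ᶠ y in 𝓝 x, bump I F E x y = 1 :=
    ProlongationSection.eventually_bump_eq_one (I := I) (F := F) (E := E) x
  -- The E-component of the lift is the identity, so the frame coefficients of `σ` come from those
  -- of the `W b` along γ.
  have e1 : (sectionCoeff x σ j : Q → ℝ) =ᶠ[𝓝 x]
      fun y => ∑ b, c b y * (W b).coeff x j (dualSection γ₀ γs y) := by
    filter_upwards [hσ, hbump] with y hy hb
    have h1 : σ y = ∑ b, c b y • (W b).fst (dualSection γ₀ γs y) := by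
      have := congrArg (fun w => w.1.1) hy
      simp only [Submodule.coe_sum, Submodule.coe_smul, Prod.fst_sum, Prod.smul_fst] at this
      exact this
    change coframe I F E x j ⟨y, σ y⟩ = _
    rw [h1]
    refine (coframe_sum x y j Finset.univ _).trans (Finset.sum_congr rfl fun b _ => ?_)
    exact coframe_smul x y j _ _ hb
  have e2 : Z.coeff x j ∘ dualSection γ₀ γs =ᶠ[𝓝 x]
      fun y => ∑ b, (g b ∘ dualSection γ₀ γs) y * (W b).coeff x j (dualSection γ₀ γs y) := by
    filter_upwards [hγ.continuousAt.eventually hZ, hbump] with y hy hb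
    have h1 : Z.fst (dualSection γ₀ γs y) =
        ∑ b, g b (dualSection γ₀ γs y) • (W b).fst (dualSection γ₀ γs y) := by
      have := congrArg (fun w => w.1.1) hy
      simp only [Submodule.coe_sum, Submodule.coe_smul, Prod.fst_sum, Prod.smul_fst] at this
      exact this
    change coframe I F E x j ⟨y, Z.fst (dualSection γ₀ γs y)⟩ = _
    rw [h1]
    refine (coframe_sum x y j Finset.univ _).trans (Finset.sum_congr rfl fun b _ => ?_)
    exact coframe_smul x y j _ _ hb
  rw [← mvfderiv_comp_apply x ((Z.contMDiff_coeff x j _).mdifferentiableAt (by simp)) hγ,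
    mvfderiv_congr e2]
  change mvfderiv I (sectionCoeff x σ j : Q → ℝ) x (𝓔.anchor x (τ x)) - _ = _
  rw [mvfderiv_congr e1]
  exact mvfderiv_sum_mul_sub c (fun b => g b ∘ dualSection γ₀ γs)
    (fun b y => (W b).coeff x j (dualSection γ₀ γs y)) x hc (fun b => (hg b).comp x hγ)
    (fun b => (((W b).contMDiff_coeff x j _).mdifferentiableAt (by simp)).comp x hγ) hcg _

/-- How far the brackets of sections of `E` and of sections of the prolongation with the same
values at one point are from being related by `liftMap`. -/
theorem liftMap_bracket_sub (x : Q) (W : ι → 𝓔.ProlongationSection (dualModel I F) dualProj)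
    (σ₁ σ₂ : Cₛ^∞⟮I; F, E⟯) (Z₁ Z₂ : 𝓔.ProlongationSection (dualModel I F) dualProj)
    (c₁ c₂ : ι → Q → ℝ) (g₁ g₂ : ι → DualR F E → ℝ)
    (hc₁ : ∀ b, MDifferentiableAt I 𝓘(ℝ, ℝ) (c₁ b) x)
    (hc₂ : ∀ b, MDifferentiableAt I 𝓘(ℝ, ℝ) (c₂ b) x)
    (hg₁ : ∀ b, MDifferentiableAt (dualModel I F) 𝓘(ℝ, ℝ) (g₁ b) (dualSection γ₀ γs x))
    (hg₂ : ∀ b, MDifferentiableAt (dualModel I F) 𝓘(ℝ, ℝ) (g₂ b) (dualSection γ₀ γs x))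
    (hcg₁ : ∀ b, c₁ b x = g₁ b (dualSection γ₀ γs x))
    (hcg₂ : ∀ b, c₂ b x = g₂ b (dualSection γ₀ γs x))
    (hσ₁ : ∀ᶠ y in 𝓝 x, 𝓔.liftMap γ₀ γs y (σ₁ y) =
      ∑ b, c₁ b y • (W b).eval (dualSection γ₀ γs y))
    (hσ₂ : ∀ᶠ y in 𝓝 x, 𝓔.liftMap γ₀ γs y (σ₂ y) =
      ∑ b, c₂ b y • (W b).eval (dualSection γ₀ γs y))
    (hZ₁ : ∀ᶠ z in 𝓝 (dualSection γ₀ γs x), Z₁.eval z = ∑ b, g₁ b z • (W b).eval z)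
    (hZ₂ : ∀ᶠ z in 𝓝 (dualSection γ₀ γs x), Z₂.eval z = ∑ b, g₂ b z • (W b).eval z) :
    𝓔.liftMap γ₀ γs x (𝓔.bracket σ₁ σ₂ x) -
        (ProlongationSection.bracket (contMDiff_dualProj I F E) Z₁ Z₂).eval (dualSection γ₀ γs x) =
      (∑ b, (mvfderiv I (c₂ b) x (𝓔.anchor x (σ₁ x)) -
        mvfderiv I (g₂ b ∘ dualSection γ₀ γs) x (𝓔.anchor x (σ₁ x))) •
          (W b).eval (dualSection γ₀ γs x)) -
      ∑ b, (mvfderiv I (c₁ b) x (𝓔.anchor x (σ₂ x)) -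
        mvfderiv I (g₁ b ∘ dualSection γ₀ γs) x (𝓔.anchor x (σ₂ x))) •
          (W b).eval (dualSection γ₀ γs x) := by
  have hval : ∀ (σ : Cₛ^∞⟮I; F, E⟯) (Z : 𝓔.ProlongationSection (dualModel I F) dualProj)
      (c : ι → Q → ℝ) (g : ι → DualR F E → ℝ), (∀ b, c b x = g b (dualSection γ₀ γs x)) →
      (∀ᶠ y in 𝓝 x, 𝓔.liftMap γ₀ γs y (σ y) = ∑ b, c b y • (W b).eval (dualSection γ₀ γs y)) →
      (∀ᶠ z in 𝓝 (dualSection γ₀ γs x), Z.eval z = ∑ b, g b z • (W b).eval z) →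
      Z.eval (dualSection γ₀ γs x) = 𝓔.liftMap γ₀ γs x (σ x) := by
    intro σ Z c g hcg hσ hZ
    rw [hσ.self_of_nhds, hZ.self_of_nhds]
    simp only [hcg]
  have hv₁ := hval σ₁ Z₁ c₁ g₁ hcg₁ hσ₁ hZ₁
  have hv₂ := hval σ₂ Z₂ c₂ g₂ hcg₂ hσ₂ hZ₂
  have hf₁ : Z₁.fst (dualSection γ₀ γs x) = σ₁ x := congrArg (fun w => w.1.1) hv₁
  have hf₂ : Z₂.fst (dualSection γ₀ γs x) = σ₂ x := congrArg (fun w => w.1.1) hv₂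
  have hw₁ : Z₁.vec (dualSection γ₀ γs x) =
      mfderiv I (dualModel I F) (dualSection γ₀ γs) x (𝓔.anchor x (σ₁ x)) :=
    congrArg (fun w => w.1.2) hv₁
  have hw₂ : Z₂.vec (dualSection γ₀ γs x) =
      mfderiv I (dualModel I F) (dualSection γ₀ γs) x (𝓔.anchor x (σ₂ x)) :=
    congrArg (fun w => w.1.2) hv₂
  have hbump : ∀ᶠ y in 𝓝 x, bump I F E x y = 1 :=
    ProlongationSection.eventually_bump_eq_one (I := I) (F := F) (E := E) x
  apply Subtype.ext
  refine Prod.ext ?_ ?_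
  · simp only [Submodule.coe_sub, Submodule.coe_sum, Submodule.coe_smul, Prod.fst_sub,
      Prod.fst_sum, Prod.smul_fst]
    let w : ι → E x := fun b => (W b).fst (dualSection γ₀ γs x)
    let B : E x := ProlongationSection.bracketFst Z₁ Z₂ x (dualSection γ₀ γs x)
    change 𝓔.bracket σ₁ σ₂ x - B = (∑ b, _ • w b) - ∑ b, _ • w b
    -- The E-components of the `W b` are rewritten in the frame of E at `x`, where
    -- `anchorDeriv_sectionCoeff_sub` identifies the coefficients.
    have hs : ∀ δ : ι → ℝ, ∑ b, δ b • w b =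
        ∑ j, (∑ b, δ b * (W b).coeff x j (dualSection γ₀ γs x)) • frame I F E x j x := by
      intro δ
      have h : ∀ b, w b = ∑ j, (W b).coeff x j (dualSection γ₀ γs x) • frame I F E x j x :=
        fun b => (W b).fst_eq x (dualSection γ₀ γs x) hbump.self_of_nhds
      simp only [h, Finset.smul_sum, smul_smul, Finset.sum_smul]
      exact Finset.sum_comm
    rw [hs, hs]
    simp only [← anchorDeriv_sectionCoeff_sub 𝓔 γ₀ γs x W σ₂ σ₁ Z₂ c₂ g₂ hc₂ hg₂ hcg₂ hσ₂ hZ₂,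
      ← anchorDeriv_sectionCoeff_sub 𝓔 γ₀ γs x W σ₁ σ₂ Z₁ c₁ g₁ hc₁ hg₁ hcg₁ hσ₁ hZ₁,
      ← hw₁, ← hw₂, sub_smul, Finset.sum_sub_distrib]
    have hk : ∀ (σ : Cₛ^∞⟮I; F, E⟯) (Z : 𝓔.ProlongationSection (dualModel I F) dualProj),
        Z.fst (dualSection γ₀ γs x) = σ x → ∀ i,
        Z.coeff x i (dualSection γ₀ γs x) = sectionCoeff x σ i x := by
      intro σ Z h i
      change coframe I F E x i ⟨x, Z.fst (dualSection γ₀ γs x)⟩ = _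
      rw [h]
      rfl
    -- The coefficients of `Z₁`, `Z₂` at the point are those of `σ₁`, `σ₂`. Hence the terms with
    -- brackets of frame sections equal those in `bracket_eq_sum` and cancel.
    have hB : B = (∑ i, ∑ j, (sectionCoeff x σ₁ i x * sectionCoeff x σ₂ j x) •
          𝓔.bracket (frame I F E x i) (frame I F E x j) x) +
        (∑ j, mvfderiv (dualModel I F) (Z₂.coeff x j) (dualSection γ₀ γs x)
          (Z₁.vec (dualSection γ₀ γs x)) • frame I F E x j x) -
        ∑ i, mvfderiv (dualModel I F) (Z₁.coeff x i) (dualSection γ₀ γs x)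
          (Z₂.vec (dualSection γ₀ γs x)) • frame I F E x i x := by
      simp only [← hk σ₁ Z₁ hf₁, ← hk σ₂ Z₂ hf₂]
      rfl
    rw [𝓔.bracket_eq_sum σ₁ σ₂ x x hbump, hB]
    have hab : ∀ s a b a' b' : E x, s + a - b - (s + a' - b') = a - a' - (b - b') := by
      intros; abel
    exact hab _ _ _ _ _
  · simp only [Submodule.coe_sub, Submodule.coe_sum, Submodule.coe_smul, Prod.snd_sub,
      Prod.snd_sum, Prod.smul_snd]
    have : T2Space (TotalSpace (F →L[ℝ] ℝ) (DualFiber E)) :=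
      FiberBundle.t2Space_totalSpace _ _
    have hvec : ∀ {n : Q → ι → ℝ} {y : Q} {σ : Cₛ^∞⟮I; F, E⟯}, 𝓔.liftMap γ₀ γs y (σ y) =
        ∑ b, n y b • (W b).eval (dualSection γ₀ γs y) →
        mfderiv I (dualModel I F) (dualSection γ₀ γs) y (𝓔.anchor y (σ y)) =
          ∑ b, n y b • (W b).vec (dualSection γ₀ γs y) := by
      intro n y σ hy
      have := congrArg (fun w => w.1.2) hy
      simp only [Submodule.coe_sum, Submodule.coe_smul, Prod.snd_sum, Prod.smul_snd] at this
      exact this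
    have hvec' : ∀ {n : DualR F E → ι → ℝ} {z : DualR F E}
        {Z : 𝓔.ProlongationSection (dualModel I F) dualProj}, Z.eval z =
        ∑ b, n z b • (W b).eval z → Z.vec z = ∑ b, n z b • (W b).vec z := by
      intro n z Z hz
      have := congrArg (fun w => w.1.2) hz
      simp only [Submodule.coe_sum, Submodule.coe_smul, Prod.snd_sum, Prod.smul_snd] at this
      exact this
    exact mfderiv_commutator_sub (dualSection γ₀ γs) (contMDiff_dualSection γ₀ γs) x
      (fun y => 𝓔.anchor y (σ₁ y)) (fun y => 𝓔.anchor y (σ₂ y)) Z₁.vec Z₂.vec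
      Z₁.contMDiff_vec Z₂.contMDiff_vec (fun b => (W b).vec) (fun b => (W b).contMDiff_vec)
      c₁ c₂ g₁ g₂ hc₁ hc₂ hg₁ hg₂ hcg₁ hcg₂
      (hσ₁.mono fun y hy => hvec (n := fun y b => c₁ b y) hy)
      (hσ₂.mono fun y hy => hvec (n := fun y b => c₂ b y) hy)
      (hZ₁.mono fun z hz => hvec' (n := fun z b => g₁ b z) hz)
      (hZ₂.mono fun z hz => hvec' (n := fun z b => g₂ b z) hz)
      hw₁ hw₂ (𝓔.anchor x (𝓔.bracket σ₁ σ₂ x))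
      -- The anchor is a homomorphism of brackets: this is where the Jacobi identity of E enters.
      (fun h hh => 𝓔.anchorDeriv_bracket σ₁ σ₂ ⟨h, hh⟩ x)

/-- The prolongation over `E* × ℝ` is spanned near a point of the image of `γ` by finitely many
sections, with coefficients that depend smoothly on the point. -/
theorem exists_frame_contactProlongation (x : Q) :
    ∃ (W : Fin (finrank ℝ F) ⊕ Fin (finrank ℝ ((EQ × (F →L[ℝ] ℝ)) × ℝ)) →
        𝓔.ProlongationSection (dualModel I F) dualProj)
      (θ : Fin (finrank ℝ F) ⊕ Fin (finrank ℝ ((EQ × (F →L[ℝ] ℝ)) × ℝ)) →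
        ∀ p, 𝓔.contactProlongation p → ℝ),
      (∀ᶠ p in 𝓝 (dualSection γ₀ γs x), ∀ w, w = ∑ b, θ b p w • (W b).eval p) ∧
      (∀ (σ : Cₛ^∞⟮I; F, E⟯) b, ContMDiffAt I 𝓘(ℝ, ℝ) ∞
        (fun y => θ b (dualSection γ₀ γs y) (𝓔.liftMap γ₀ γs y (σ y))) x) ∧
      ∀ (Z : 𝓔.ProlongationSection (dualModel I F) dualProj) b,
        ContMDiffAt (dualModel I F) 𝓘(ℝ, ℝ) ∞ (fun p => θ b p (Z.eval p)) (dualSection γ₀ γs x) := by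
  have h := isLinearProjectionOver_dualProj (I := I) (dualSection γ₀ γs x)
  obtain ⟨ψ, -, hψ⟩ := (SmoothBumpFunction.nhds_basis_tsupport (I := I)
    (dualProj (dualSection γ₀ γs x))).mem_iff.1 (h.isOpen.mem_nhds h.mem)
  have hc : Continuous (dualProj : DualR F E → Q) := (contMDiff_dualProj I F E).continuous
  refine ⟨h.frameSection ψ hψ, IsLinearProjectionOver.frameCoeff (dualModel I F) dualProj 𝓔
    (dualSection γ₀ γs x), ?_, fun σ b => ?_, fun Z b => ?_⟩
  · filter_upwards [hc.continuousAt.eventually (h.isOpen.mem_nhds h.mem),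
      hc.continuousAt.eventually ψ.eventuallyEq_one,
      hc.continuousAt.eventually (ProlongationSection.eventually_bump_eq_one (I := I) (F := F)
        (E := E) (dualProj (dualSection γ₀ γs x)))] with p h1 h2 h3 w
    exact h.sum_frameCoeff_smul_frameSection ψ hψ p h1 h2 h3 w
  · refine IsLinearProjectionOver.contMDiffAt_frameCoeff (dualSection γ₀ γs) x
      (fun y => 𝓔.liftMap γ₀ γs y (σ y)) ?_ ?_ b
    · exact σ.contMDiff x
    -- The tangent component of the lift of `σ` is the tangent map of γ composed with the smooth
    -- vector field `ρ(σ)`.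
    · exact (((contMDiff_dualSection γ₀ γs).contMDiff_tangentMap (m := ∞) le_rfl).comp
        (𝓔.contMDiff_anchor_section σ)) x
  · exact IsLinearProjectionOver.contMDiffAt_frameCoeff id (dualSection γ₀ γs x)
      (fun p => Z.eval p) (Z.contMDiff_fst _) (Z.contMDiff_vec _) b

/-- Both smoothness and compatibility with d are local, so the general criteria apply with the
spanning family `W` near `γ(x)` and the coefficients given by `θ`. -/
theorem isLieAlgebroidMorphism_liftMap :
    IsLieAlgebroidMorphism 𝓔.data 𝓔.contactProlongationData
      (dualSection γ₀ γs) (𝓔.liftMap γ₀ γs) where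
  contMDiff_base := contMDiff_dualSection γ₀ γs
  smooth_pullback {k} μ hμ := by
    refine isSmoothForm_pullbackForm_of_frame
      (ι := Fin (finrank ℝ F) ⊕ Fin (finrank ℝ ((EQ × (F →L[ℝ] ℝ)) × ℝ))) 𝓔.data 𝓔.contactProlongationData _
      (contMDiff_dualSection γ₀ γs) _ (fun x => ?_) μ hμ
    obtain ⟨W, θ, hW, hσ, -⟩ := 𝓔.exists_frame_contactProlongation γ₀ γs x
    refine ⟨W, fun σ => ⟨_, hσ σ, ?_⟩⟩
    filter_upwards [(mdifferentiableAt_dualSection γ₀ γs x).continuousAt.eventually hW] with y hy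
    exact hy _
  extDeriv_pullback {k} μ hμ x σ Z hσZ := by
    obtain ⟨W, θ, hW, hσ, hZ⟩ := 𝓔.exists_frame_contactProlongation γ₀ γs x
    have hγ := mdifferentiableAt_dualSection γ₀ γs x
    let s : Fin (k + 1) → Cₛ^∞⟮I; F, E⟯ := σ
    let z : Fin (k + 1) → 𝓔.ProlongationSection (dualModel I F) dualProj := Z
    have hc := fun i b => (hσ (s i) b).mdifferentiableAt (by simp)
    have hg := fun i b => (hZ (z i) b).mdifferentiableAt (by simp)
    -- A vector does not determine its coefficients in a redundant family. They agree here because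
    -- both sides use the same functions `θ`.
    have hcg : ∀ i b, θ b (dualSection γ₀ γs x) (𝓔.liftMap γ₀ γs x (s i x)) =
        θ b (dualSection γ₀ γs x) ((z i).eval (dualSection γ₀ γs x)) := fun i b =>
      congrArg _ (hσZ i).symm
    have hσ' := fun i => (hγ.continuousAt.eventually hW).mono
      fun y hy => hy (𝓔.liftMap γ₀ γs y (s i y))
    have hZ' := fun i => hW.mono fun p hp => hp ((z i).eval p)
    exact extDeriv_pullbackForm_of_frame 𝓔.data 𝓔.contactProlongationData _ _ x hγ W μ hμ σ Z
      (fun i b y => θ b (dualSection γ₀ γs y) (𝓔.liftMap γ₀ γs y (s i y)))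
      (fun i b p => θ b p ((z i).eval p)) hc hg hcg hσ' hZ'
      -- The anchor of the prolongation is the tangent component, so compatibility of the anchors is
      -- half of the matching assumption.
      (fun i => congrArg (fun w => w.1.2) (hσZ i))
      (fun i j => 𝓔.liftMap_bracket_sub γ₀ γs x W (s i) (s j) (z i) (z j) _ _ _ _
        (hc i) (hc j) (hg i) (hg j) (hcg i) (hcg j) (hσ' i) (hσ' j) (hZ' i) (hZ' j))

/-- The chain rule for `s ∘ γ = γₛ` gives the differential. The Liouville part gives `γ₀` directly,
as the E-component of the lift is `a` itself. -/
theorem pullbackForm_contactForm (q : Q) (a : E q) :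
    pullbackForm (dualSection γ₀ γs) (𝓔.liftMap γ₀ γs) 𝓔.contactForm q (fun _ => a) =
      𝓔.differential γs q a - γ₀ q a := by
  have h : mvfderiv (dualModel I F) (Prod.snd : DualR F E → ℝ) (dualSection γ₀ γs q)
      (mfderiv I (dualModel I F) (dualSection γ₀ γs) q (𝓔.anchor q a)) =
      mvfderiv I γs q (𝓔.anchor q a) := by
    rw [← mvfderiv_comp_apply q (contMDiff_snd (n := ∞) _ |>.mdifferentiableAt (by simp))
      (mdifferentiableAt_dualSection γ₀ γs q)]
    rfl
  exact congrArg (· - γ₀ q a) h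

end LieAlgebroid

end Contact

end

theorem mainTheorem5
    {EQ : Type*} [NormedAddCommGroup EQ] [NormedSpace ℝ EQ] [FiniteDimensional ℝ EQ]
    {HQ : Type*} [TopologicalSpace HQ] {I : ModelWithCorners ℝ EQ HQ} [I.Boundaryless]
    {Q : Type*} [TopologicalSpace Q] [ChartedSpace HQ Q] [IsManifold I ∞ Q] [T2Space Q]
    {F : Type*} [NormedAddCommGroup F] [NormedSpace ℝ F] [FiniteDimensional ℝ F]
    {E : Q → Type*} [∀ q, AddCommGroup (E q)] [∀ q, Module ℝ (E q)]
    [TopologicalSpace (TotalSpace F E)] [∀ q, TopologicalSpace (E q)]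
    [∀ q, IsTopologicalAddGroup (E q)] [∀ q, ContinuousSMul ℝ (E q)]
    [FiberBundle F E] [VectorBundle ℝ F E] [ContMDiffVectorBundle ∞ F E I]
    (𝓔 : LieAlgebroid I F E)
    (γ₀ : Cₛ^∞⟮I; F →L[ℝ] ℝ, DualFiber E⟯) (γs : C^∞⟮I, Q; ℝ⟯) :
    IsLieAlgebroidMorphism 𝓔.data 𝓔.contactProlongationData
        (dualSection γ₀ γs) (𝓔.liftMap γ₀ γs) ∧
      ∀ (q : Q) (a : E q),
        pullbackForm (dualSection γ₀ γs) (𝓔.liftMap γ₀ γs) 𝓔.contactForm q (fun _ => a) =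
          𝓔.differential γs q a - γ₀ q a :=
  ⟨𝓔.isLieAlgebroidMorphism_liftMap γ₀ γs, 𝓔.pullbackForm_contactForm γ₀ γs⟩
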